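/- Let $N\simeq\mathbf{Z}^r$ be a lattice, $N_{\mathbf{R}}=N\otimes_{\mathbf{Z}}\mathbf{R}$, and let $S\subseteq N$ be a finitely generated, saturated subsemigroup containing $0$; that is, if $C\subseteq N_{\mathbf{R}}$ is the convex cone generated by $S$ (a rational polyhedral cone), then $S=C\cap N$. Let $V$ be a Noetherian scheme, and let $\mathfrak{a}_\bullet=(\mathfrak{a}_m)_{m\in S}$ be an $S$-graded system of ideals on $V$: a family of (quasi-coherent) ideal sheaves $\mathfrak{a}_m\subseteq\mathcal{O}_V$ with $\mathfrak{a}_0=\mathcal{O}_V$ and $\mathfrak{a}_m\cdot\mathfrak{a}_{m'}\subseteq\mathfrak{a}_{m+m'}$ for all $m,m'\in S$. Assume that $\mathfrak{a}_\bullet$ is finitely generated, i.e. that the Rees algebra $\bigoplus_{m\in S}\mathfrak{a}_m$ is a finitely generated $\mathcal{O}_V$-algebra. Write $\overline{\mathfrak{a}}$ for the integral closure of an ideal sheaf $\mathfrak{a}$. A fan in $N_{\mathbf{R}}$ is a finite fan of strongly convex rational polyhedral cones; it is smooth if each of its cones is generated by part of a $\mathbf{Z}$-basis of $N$; its support is the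 union of its cones; a refinement of a fan is a fan with the same support, each of whose cones is contained in a cone of the given one. Then there is a smooth fan $\Delta$ in $N_{\mathbf{R}}$ with support $C$ such that for every smooth refinement $\Delta'$ of $\Delta$ there is a positive integer $d$ with the following property. For every cone $\sigma\in\Delta'$, if $e_1,\ldots,e_s$ denote the (minimal) generators of the semigroup $\sigma\cap N$, then $$\overline{\mathfrak{a}_{d\sum_i p_ie_i}}=\overline{\prod_i\mathfrak{a}_{de_i}^{p_i}}$$ for every $p=(p_i)\in\mathbf{N}^s$. -/

import Mathlib

open AlgebraicGeometry
open scoped TensorProduct Polynomial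

universe u v

namespace GradedIdeals

section IntegralClosure

variable {R : Type*} [CommRing R]

/-- `x` is integral over the ideal `I`: it satisfies an equation
`x ^ n + c_{n-1} x ^ (n-1) + ⋯ + c_1 x + c_0 = 0` with `c_i ∈ I ^ (n - i)`. -/
def IsIntegralOverIdeal (I : Ideal R) (x : R) : Prop :=
  ∃ (n : ℕ) (c : ℕ → R), (∀ i < n, c i ∈ I ^ (n - i)) ∧
    x ^ n + ∑ i ∈ Finset.range n, c i * x ^ i = 0

/-- Integrality over `I` is integrality of `x t` over the Rees algebra `R[I t]`. -/
theorem isIntegralOverIdeal_iff (I : Ideal R) (x : R) :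
    IsIntegralOverIdeal I x ↔ IsIntegral (reesAlgebra I) (Polynomial.monomial 1 x : R[X]) := by
  constructor
  · rintro ⟨n, c, hc, h⟩
    nontriviality R
    have : Nontrivial (reesAlgebra I) := inferInstance
    let b : ℕ → reesAlgebra I := fun i =>
      if hi : i < n then ⟨Polynomial.monomial (n - i) (c i),
        reesAlgebra.monomial_mem.mpr (hc i hi)⟩ else 0
    let q : (reesAlgebra I)[X] :=
      ∑ i ∈ Finset.range n, Polynomial.C (b i) * Polynomial.X ^ i
    have hq : q.degree < n := by
      refine (Polynomial.degree_sum_le _ _).trans_lt ?_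
      rw [Finset.sup_lt_iff (by exact_mod_cast WithBot.bot_lt_coe n)]
      intro i hi
      refine (Polynomial.degree_C_mul_X_pow_le i (b i)).trans_lt ?_
      exact_mod_cast Finset.mem_range.mp hi
    refine ⟨Polynomial.X ^ n + q, Polynomial.monic_X_pow_add hq, ?_⟩
    have key : ∀ i ∈ Finset.range n,
        (algebraMap (reesAlgebra I) R[X] (b i)) * (Polynomial.monomial 1 x : R[X]) ^ i
          = Polynomial.monomial n (c i * x ^ i) := by
      intro i hi
      have hi' := Finset.mem_range.mp hi
      have : algebraMap (reesAlgebra I) R[X] (b i) = Polynomial.monomial (n - i) (c i) := by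
        simp [b, hi']
      rw [this, Polynomial.monomial_pow, Polynomial.monomial_mul_monomial, one_mul,
        Nat.sub_add_cancel hi'.le]
    rw [Polynomial.eval₂_add, Polynomial.eval₂_X_pow, Polynomial.eval₂_finsetSum]
    simp only [Polynomial.eval₂_mul, Polynomial.eval₂_C, Polynomial.eval₂_X_pow]
    rw [Finset.sum_congr rfl key, Polynomial.monomial_pow, one_mul, ← map_sum, ← map_add, h,
      map_zero]
  · rintro ⟨p, hp, h⟩
    refine ⟨p.natDegree, fun i => (p.coeff i).1.coeff (p.natDegree - i),
      fun i _ => (p.coeff i).2 _, ?_⟩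
    have h' := congrArg (fun f : R[X] => f.coeff p.natDegree) h
    simp only [Polynomial.eval₂_eq_sum_range, Polynomial.finsetSum_coeff,
      Polynomial.coeff_zero] at h'
    rw [← h', Finset.sum_range_succ, add_comm]
    congr 1
    · refine Finset.sum_congr rfl fun i hi => ?_
      have hi' := Finset.mem_range.mp hi
      rw [Polynomial.monomial_pow, one_mul, ← Polynomial.C_mul_X_pow_eq_monomial, ← mul_assoc,
        Polynomial.coeff_mul_X_pow', if_pos hi'.le, Polynomial.coeff_mul_C]
      rfl
    · rw [hp.coeff_natDegree, map_one, one_mul, Polynomial.monomial_pow, one_mul,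
        Polynomial.coeff_monomial, if_pos rfl]

/-- The integral closure of an ideal `I` of `R` (in `R`). -/
def integralClosure (I : Ideal R) : Ideal R where
  carrier := {x | IsIntegralOverIdeal I x}
  zero_mem' := by
    rw [Set.mem_ofPred_eq, isIntegralOverIdeal_iff]
    simpa using isIntegral_zero
  add_mem' := by
    intro x y hx hy
    rw [Set.mem_ofPred_eq, isIntegralOverIdeal_iff] at *
    rw [map_add]
    exact hx.add hy
  smul_mem' := by
    intro r x hx
    rw [Set.mem_ofPred_eq, isIntegralOverIdeal_iff] at *
    have h : (Polynomial.monomial 1 (r • x) : R[X]) =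
        algebraMap (reesAlgebra I) R[X] (algebraMap R (reesAlgebra I) r) *
          Polynomial.monomial 1 x := by
      rw [← IsScalarTower.algebraMap_apply, Polynomial.algebraMap_eq,
        Polynomial.C_mul_monomial, smul_eq_mul]
    rw [h]
    exact isIntegral_algebraMap.mul hx

theorem mem_integralClosure {I : Ideal R} {x : R} :
    x ∈ integralClosure I ↔ IsIntegralOverIdeal I x := Iff.rfl

theorem le_integralClosure (I : Ideal R) : I ≤ integralClosure I := fun x hx =>
  ⟨1, fun _ => -x, by simpa using hx, by simp⟩

theorem integralClosure_le_radical (I : Ideal R) : integralClosure I ≤ I.radical := by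
  rintro x ⟨n, c, hc, h⟩
  refine ⟨n, ?_⟩
  rw [eq_neg_of_add_eq_zero_left h]
  refine neg_mem (sum_mem fun i hi => I.mul_mem_right _ ?_)
  have hi' := Finset.mem_range.mp hi
  exact Ideal.pow_le_self (by omega) (hc i hi')

/-- Formation of the integral closure commutes with localization. -/
theorem map_integralClosure (M : Submonoid R) (R' : Type*) [CommRing R'] [Algebra R R']
    [IsLocalization M R'] (I : Ideal R) :
    (integralClosure I).map (algebraMap R R') = integralClosure (I.map (algebraMap R R')) := by
  apply le_antisymm
  · rw [Ideal.map_le_iff_le_comap]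
    rintro x ⟨n, c, hc, h⟩
    refine ⟨n, fun i => algebraMap R R' (c i), fun i hi => ?_, ?_⟩
    · rw [← Ideal.map_pow]
      exact Ideal.mem_map_of_mem _ (hc i hi)
    · have := congrArg (algebraMap R R') h
      simpa using this
  · rintro y ⟨n, c, hc, h⟩
    have hc' : ∀ i, ∃ s : M, ∃ b : R, i < n → b ∈ I ^ (n - i) ∧
        algebraMap R R' b = algebraMap R R' s * c i := by
      intro i
      by_cases hi : i < n
      · have h1 := hc i hi
        rw [← Ideal.map_pow, IsLocalization.mem_map_algebraMap_iff M] at h1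
        obtain ⟨⟨b, s⟩, hb⟩ := h1
        exact ⟨s, b, fun _ => ⟨b.2, by rw [← hb, mul_comm]⟩⟩
      · exact ⟨1, 0, fun h => absurd h hi⟩
    choose s b hb using hc'
    obtain ⟨⟨x, s₀⟩, hx⟩ := IsLocalization.surj M y
    let t : M := s₀ * ∏ i ∈ Finset.range n, s i
    let w : M := ∏ i ∈ Finset.range n, s i
    -- after clearing denominators, `t y` is the image of `w x`
    have hty : algebraMap R R' t * y = algebraMap R R' (w * x) := by
      have : (t : R) = s₀ * w := rfl
      rw [this, map_mul, map_mul, ← hx]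
      ring
    have hd : ∀ i, ∃ d : R, i < n → d ∈ I ^ (n - i) ∧
        algebraMap R R' d = algebraMap R R' t ^ (n - i) * c i := by
      intro i
      by_cases hi : i < n
      · obtain ⟨k, hk⟩ : (s i) ∣ t :=
          (Finset.dvd_prod_of_mem s (Finset.mem_range.mpr hi)).mul_left s₀
        refine ⟨k * t ^ (n - i - 1) * b i, fun _ =>
          ⟨Ideal.mul_mem_left _ _ (hb i hi).1, ?_⟩⟩
        have h2 : n - i = (n - i - 1) + 1 := by omega
        rw [map_mul, (hb i hi).2]
        conv_rhs => rw [h2, pow_succ]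
        rw [map_mul, map_pow]
        have h3 : algebraMap R R' (t : R) = algebraMap R R' (s i) * algebraMap R R' (k : R) := by
          rw [← map_mul]
          exact congrArg (fun z : M => algebraMap R R' z) hk
        nth_rewrite 3 [h3]
        ring
      · exact ⟨0, fun h => absurd h hi⟩
    choose d hd using hd
    have hz : algebraMap R R' ((w * x) ^ n + ∑ i ∈ Finset.range n, d i * (w * x) ^ i) = 0 := by
      rw [map_add, map_pow, map_sum, ← hty]
      have : ∀ i ∈ Finset.range n, algebraMap R R' (d i * (w * x) ^ i) =
          algebraMap R R' t ^ n * (c i * y ^ i) := by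
        intro i hi
        have hi' := Finset.mem_range.mp hi
        rw [map_mul, map_pow, ← hty, (hd i hi').2]
        have h2 : n = (n - i) + i := by omega
        conv_rhs => rw [h2, pow_add]
        ring
      rw [Finset.sum_congr rfl this, ← Finset.mul_sum, mul_pow, ← mul_add, h, mul_zero]
    obtain ⟨m, hm⟩ := (IsLocalization.map_eq_zero_iff M R' _).mp hz
    have hmem : (m : R) * (w * x) ∈ integralClosure I := by
      rcases Nat.eq_zero_or_pos n with hn | hn
      · subst hn
        have : (m : R) = 0 := by simpa using hm
        rw [this, zero_mul]
        exact zero_mem _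
      refine ⟨n, fun i => m ^ (n - i) * d i, fun i hi => Ideal.mul_mem_left _ _ (hd i hi).1, ?_⟩
      have : ∀ i ∈ Finset.range n, (m : R) ^ (n - i) * d i * (m * (w * x)) ^ i =
          m ^ n * (d i * (w * x) ^ i) := by
        intro i hi
        have hi' := Finset.mem_range.mp hi
        have h2 : (m : R) ^ n = m ^ (n - i) * m ^ i := by
          rw [← pow_add, Nat.sub_add_cancel hi'.le]
        rw [h2]
        rw [mul_pow (m : R) (w * x) i]
        ring
      rw [Finset.sum_congr rfl this, ← Finset.mul_sum, mul_pow, ← mul_add]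
      obtain ⟨k, rfl⟩ : ∃ k, n = k + 1 := ⟨n - 1, by omega⟩
      rw [pow_succ, mul_assoc, hm, mul_zero]
    rw [IsLocalization.mem_map_algebraMap_iff M]
    refine ⟨⟨⟨_, hmem⟩, m * t⟩, ?_⟩
    simp only [Submonoid.coe_mul, map_mul]
    rw [mul_comm, mul_assoc, hty, map_mul]

end IntegralClosure
section Fans

variable (N : Type u) [AddCommGroup N]

/-- The real vector space `N_ℝ = ℝ ⊗ N` of a lattice `N`. -/
abbrev RealSpan : Type u := ℝ ⊗[ℤ] N

/-- The canonical map `N → N_ℝ`; it is injective when `N` is free. -/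
noncomputable def toReal : N →+ RealSpan N :=
  (TensorProduct.mk ℤ ℝ N 1).toAddMonoidHom

variable {N}

/-- The convex cone in `N_ℝ` generated by a subset of the lattice. -/
noncomputable def coneOf (T : Set N) : PointedCone ℝ (RealSpan N) :=
  PointedCone.hull ℝ (toReal N '' T)

/-- The semigroup `σ ∩ N` of lattice points of a cone `σ`. -/
noncomputable def latticePoints (σ : PointedCone ℝ (RealSpan N)) : AddSubmonoid N :=
  σ.toAddSubmonoid.comap (toReal N)

/-- A subsemigroup `S` of `N` is saturated if `S = C ∩ N`, for the cone `C` generated by `S`. -/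
def IsSaturated (S : AddSubmonoid N) : Prop :=
  latticePoints (coneOf (S : Set N)) = S

/-- Rational polyhedral cones. -/
def IsRationalPolyhedral (σ : PointedCone ℝ (RealSpan N)) : Prop :=
  ∃ T : Set N, T.Finite ∧ σ = coneOf T

/-- Strongly convex cones: those containing no line. -/
def IsStronglyConvex (σ : PointedCone ℝ (RealSpan N)) : Prop :=
  ∀ x, x ∈ σ → -x ∈ σ → x = 0

/-- Smooth cones: those generated by part of a `ℤ`-basis of the lattice. -/
def IsSmoothCone (σ : PointedCone ℝ (RealSpan N)) : Prop :=
  ∃ (b : Module.Basis (Fin (Module.finrank ℤ N)) ℤ N) (J : Set (Fin (Module.finrank ℤ N))),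
    σ = coneOf (b '' J)

variable (N) in
/-- A fan in `N_ℝ`: a finite collection of strongly convex rational polyhedral cones which
contains every face of each of its members, and such that any two members meet along a common
face. -/
structure Fan where
  /-- The cones of the fan. -/
  cones : Set (PointedCone ℝ (RealSpan N))
  finite : cones.Finite
  rational : ∀ σ ∈ cones, IsRationalPolyhedral σ
  stronglyConvex : ∀ σ ∈ cones, IsStronglyConvex σ
  face_mem : ∀ σ ∈ cones, ∀ τ : PointedCone ℝ (RealSpan N), τ.IsFaceOf σ → τ ∈ cones
  inf_isFaceOf : ∀ σ ∈ cones, ∀ τ ∈ cones, (σ ⊓ τ).IsFaceOf σ ∧ (σ ⊓ τ).IsFaceOf τ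

/-- A fan is smooth if all its cones are. -/
def Fan.IsSmooth (D : Fan N) : Prop := ∀ σ ∈ D.cones, IsSmoothCone σ

/-- The support of a fan: the union of its cones. -/
def Fan.support (D : Fan N) : Set (RealSpan N) := ⋃ σ ∈ D.cones, (σ : Set (RealSpan N))

/-- `D'` refines `D`: they have the same support, and each cone of `D'` lies in a cone of `D`. -/
def Fan.Refines (D' D : Fan N) : Prop :=
  D'.support = D.support ∧ ∀ σ' ∈ D'.cones, ∃ σ ∈ D.cones, σ' ≤ σ

/-- `e_1, …, e_s` are the generators of the semigroup `σ ∩ N` of a smooth cone `σ`: they generate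
it, and they are linearly independent (so that it is free on them, and they are its unique
minimal generators, up to order). -/
def AreGenerators (σ : PointedCone ℝ (RealSpan N)) {s : ℕ} (e : Fin s → N) : Prop :=
  LinearIndependent ℤ e ∧ AddSubmonoid.closure (Set.range e) = latticePoints σ

end Fans

section IdealSheaves

variable {X : Scheme.{v}}

/-- The integral closure of a (quasi-coherent) ideal sheaf, formed on each affine open. -/
noncomputable def sheafIntegralClosure (I : X.IdealSheafData) : X.IdealSheafData :=
  Scheme.IdealSheafData.mkOfMemSupportIff
    (fun U => integralClosure (I.ideal U))
    (fun U f =>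
      letI : Algebra Γ(X, U) Γ(X, X.affineBasicOpen f) :=
        (X.presheaf.map (CategoryTheory.homOfLE (X.basicOpen_le f)).op).hom.toAlgebra
      have : IsLocalization.Away f Γ(X, X.basicOpen f) :=
        U.2.isLocalization_of_eq_basicOpen _ _ rfl
      (map_integralClosure (.powers f) Γ(X, X.basicOpen f) (I.ideal U)).trans
        (congrArg integralClosure (I.map_ideal_basicOpen U f)))
    I.supportSet
    (fun U x hx => by
      rw [Scheme.IdealSheafData.mem_supportSet_iff_of_mem hx]
      have h1 : X.zeroLocus (U := U.1) (integralClosure (I.ideal U) : Set Γ(X, U)) ⊆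
          X.zeroLocus (U := U.1) (I.ideal U : Set Γ(X, U)) :=
        X.zeroLocus_mono (le_integralClosure (I.ideal U))
      have h2 : X.zeroLocus (U := U.1) ((I.ideal U).radical : Set Γ(X, U)) ⊆
          X.zeroLocus (U := U.1) (integralClosure (I.ideal U) : Set Γ(X, U)) :=
        X.zeroLocus_mono (integralClosure_le_radical (I.ideal U))
      rw [Scheme.zeroLocus_radical] at h2
      exact ⟨fun h => h2 h, fun h => h1 h⟩)

variable {N : Type u} [AddCommGroup N]

/-- An `S`-graded system of ideals on the scheme `X`. -/
structure GradedSystem (S : AddSubmonoid N) (X : Scheme.{v}) where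
  /-- The ideal sheaf `𝔞_m` for `m ∈ S`. -/
  ideal : S → X.IdealSheafData
  ideal_zero : ideal 0 = ⊤
  mul_le : ∀ m m' : S, ideal m * ideal m' ≤ ideal (m + m')

variable {S : AddSubmonoid N}

/-- The sections over the affine open `U` of the Rees algebra `⨁_{m ∈ S} 𝔞_m`: the subalgebra of
the semigroup algebra `Γ(X, U)[S]` of all elements whose coefficient in degree `m` is in `𝔞_m`. -/
def GradedSystem.reesAlgebra (a : GradedSystem S X) (U : X.affineOpens) :
    Subalgebra Γ(X, U) (AddMonoidAlgebra Γ(X, U) S) where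
  carrier := {f | ∀ m, f.coeff m ∈ (a.ideal m).ideal U}
  mul_mem' := by
    intro f g hf hg m
    classical
    rw [AddMonoidAlgebra.coeff_mul]
    refine sum_mem fun i _ => sum_mem fun j _ => ?_
    dsimp only
    split_ifs with h
    · subst h
      exact a.mul_le i j U (Ideal.mul_mem_mul (hf i) (hg j))
    · exact zero_mem _
  add_mem' := by
    intro f g hf hg m
    exact add_mem (hf m) (hg m)
  algebraMap_mem' := by
    intro r m
    classical
    rw [AddMonoidAlgebra.coe_algebraMap, Function.comp_apply, AddMonoidAlgebra.coeff_single,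
      Finsupp.single_apply]
    split_ifs with h
    · subst h
      rw [a.ideal_zero]
      trivial
    · exact zero_mem _

/-- The system is finitely generated if its Rees algebra is a finitely generated `𝒪_X`-algebra,
that is, if every point has an affine open neighbourhood over which the Rees algebra is
generated by finitely many sections. -/
def GradedSystem.FinitelyGenerated (a : GradedSystem S X) : Prop :=
  ∀ x : X, ∃ U : X.affineOpens, x ∈ U.1 ∧ (a.reesAlgebra U).FG

end IdealSheaves

end GradedIdeals

/-!
The fan and the integer `d` are combinatorial, and `d` does not depend on the refinement.

Over an affine open, finitely many homogeneous elements `x_j` of degrees `m_j` generate the Rees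
algebra, so `𝔞_n` is spanned by the monomials `x^k` with `∑ k_j m_j = n`. The real exponents
`k ≥ 0` of degree `n` form a polyhedron `P_n`; its vertices are the points whose support `J` is
such that the `m_j`, `j ∈ J`, are linearly independent, and such a vertex is a linear function
`λ_J(n)` of `n` on the simplicial cone spanned by these `m_j`. Suppose that this cone meets a cone
`σ` in an extreme subset whenever the `m_j`, `j ∈ J`, are independent. If `n = ∑ p_i e_i` with
`e_i ∈ σ` and `λ_J(n)` is a vertex of `P_n`, then `λ_J` is defined at every `e_i` with `p_i > 0`,
and `λ_J(n) = ∑ p_i λ_J(e_i)`. Choose `d` so that all the `d λ_J` are integral on lattice points.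
Then a monomial of degree `d n` has a power in the same power of `∏ 𝔞_{d e_i}^{p_i}`: by induction
on its support, a multiple of its exponent is a sum of multiples of vertices and of an effective
remainder (`exists_pow_monomial_mem`). This is the inclusion `⊆`; the other one is the
multiplicativity of the system (`integralClosure_eq_prod`).

The extremality holds as soon as the finitely many integral functionals that cut out the
simplicial cones (`exists_facets`) have constant signs on `σ`, a condition inherited by subsets
of `σ`, hence by refinements. A smooth complete fan with this property is obtained from the
coordinate orthants by star subdivisions at edges `{u, v}`, with new vertex `u + v`. These keep a
fan smooth, and if `l u > 0 > l v` with `l u - l v` as large as possible, then every new edge on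
which `l` changes sign has a smaller variation of `l`, so that the process terminates for each
functional `l` (`SmoothComplex.exists_constantSign`) without spoiling the ones treated before. If
the functionals for a finite set of generators of `S` are among those considered, then the cones
of this fan that are generated by elements of `S` cover the cone of `S`
(`support_toFan_restrict`).
-/

namespace GradedIdeals

/-! ### Integral closures of ideals -/

section IntegralClosure

variable {R : Type*} [CommRing R]

theorem isIntegralOverIdeal_of_pow_mem {I : Ideal R} {x : R} {n : ℕ} (hn : 0 < n)
    (h : x ^ n ∈ I ^ n) : IsIntegralOverIdeal I x := by
  refine ⟨n, fun i => if i = 0 then -x ^ n else 0, fun i _ => ?_, ?_⟩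
  · dsimp only
    split_ifs with hi
    · simpa [hi] using h
    · exact zero_mem _
  · simp [hn]

/-- The integral closure of an ideal is integrally closed: this is transitivity of integrality
for the inclusions of Rees algebras. -/
theorem integralClosure_le_integralClosure {I J : Ideal R} (h : I ≤ integralClosure J) :
    integralClosure I ≤ integralClosure J := by
  intro x hx
  rw [mem_integralClosure, isIntegralOverIdeal_iff] at hx ⊢
  let K := _root_.integralClosure (reesAlgebra J) R[X]
  have hK : ∀ z : reesAlgebra I, algebraMap (reesAlgebra I) R[X] z ∈ K := by
    rintro ⟨z, hz⟩
    change z ∈ K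
    rw [← adjoin_monomial_eq_reesAlgebra] at hz
    have hle : Algebra.adjoin R (Submodule.map (Polynomial.monomial 1 : R →ₗ[R] R[X]) I : Set R[X])
        ≤ K.restrictScalars R := by
      refine Algebra.adjoin_le ?_
      rintro _ ⟨y, hy, rfl⟩
      exact (isIntegralOverIdeal_iff J y).mp (h hy)
    exact hle hz
  obtain ⟨p, hp, hp0⟩ := hx
  refine isIntegral_trans (A := K) _
    ⟨p.map ((algebraMap (reesAlgebra I) R[X]).codRestrict K hK), hp.map _, ?_⟩
  rw [Polynomial.eval₂_map]
  exact hp0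

end IntegralClosure

/-! ### Monomials in homogeneous generators -/

section Monomials

variable {A : Type*} [CommRing A]

/-- The ideal generated by the monomials of degree `n` in elements `x j` of degree `m j`. -/
def monomialIdeal {S ι : Type*} [AddCommMonoid S] [Fintype ι] (m : ι → S) (x : ι → A) (n : S) :
    Ideal A :=
  Ideal.span {y | ∃ k : ι → ℕ, ∑ j, k j • m j = n ∧ y = ∏ j, x j ^ k j}

theorem mul_mem_monomialIdeal {S ι : Type*} [AddCommMonoid S] [Fintype ι] {m : ι → S} {x : ι → A}
    {n n' : S} {y y' : A} (hy : y ∈ monomialIdeal m x n) (hy' : y' ∈ monomialIdeal m x n') :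
    y * y' ∈ monomialIdeal m x (n + n') := by
  have h := Ideal.mul_mem_mul hy hy'
  rw [monomialIdeal, monomialIdeal, Ideal.span_mul_span'] at h
  refine Ideal.span_mono ?_ h
  rintro _ ⟨_, ⟨k, hk, rfl⟩, _, ⟨k', hk', rfl⟩, rfl⟩
  refine ⟨k + k', ?_, ?_⟩
  · simp [add_smul, Finset.sum_add_distrib, hk, hk']
  · simp [pow_add, Finset.prod_mul_distrib]

theorem coeff_mem_monomialIdeal {S ι : Type*} [AddCommMonoid S] [Fintype ι] {m : ι → S} {x : ι → A}
    {t : Set (AddMonoidAlgebra A S)}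
    (ht : ∀ f ∈ t, ∀ n, f.coeff n ∈ monomialIdeal m x n)
    {f : AddMonoidAlgebra A S} (hf : f ∈ Algebra.adjoin A t) (n : S) :
    f.coeff n ∈ monomialIdeal m x n := by
  classical
  induction hf using Algebra.adjoin_induction generalizing n with
  | mem f hf => exact ht f hf n
  | algebraMap r =>
    rw [AddMonoidAlgebra.coe_algebraMap, Function.comp_apply, AddMonoidAlgebra.coeff_single,
      Finsupp.single_apply]
    split_ifs with h
    · subst h
      have h1 : (1 : A) ∈ monomialIdeal m x 0 := Ideal.subset_span ⟨0, by simp, by simp⟩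
      simpa using Ideal.mul_mem_left _ r h1
    · exact zero_mem _
  | add f g _ _ hf hg => exact add_mem (hf n) (hg n)
  | mul f g _ _ hf hg =>
    rw [AddMonoidAlgebra.coeff_mul]
    refine sum_mem fun i _ => sum_mem fun j _ => ?_
    dsimp only
    split_ifs with h
    · subst h
      exact mul_mem_monomialIdeal (hf i) (hg j)
    · exact zero_mem _

/-- A finitely generated graded system has, over an affine open where its Rees algebra is
finitely generated, finitely many homogeneous generators: take the homogeneous components of a
finite set of generators. -/
theorem GradedSystem.exists_generators {N : Type u} [AddCommGroup N] {S : AddSubmonoid N}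
    {X : Scheme.{v}} (a : GradedSystem S X) (U : X.affineOpens) (h : (a.reesAlgebra U).FG) :
    ∃ (ι : Type (max u v)) (_ : Fintype ι) (m : ι → S) (x : ι → Γ(X, U)),
      (∀ j, x j ∈ (a.ideal (m j)).ideal U) ∧
        ∀ n, (a.ideal n).ideal U ≤ monomialIdeal m x n := by
  classical
  obtain ⟨t, ht⟩ := h
  let ι := {z // z ∈ t ×ˢ t.biUnion fun f => f.coeff.support}
  let m : ι → S := fun z => z.1.2
  let x : ι → Γ(X, U) := fun z => z.1.1.coeff z.1.2
  refine ⟨ι, inferInstance, m, x, ?_, ?_⟩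
  · rintro ⟨⟨f, n⟩, hz⟩
    have hf : f ∈ a.reesAlgebra U := by
      rw [← ht]
      exact Algebra.subset_adjoin (Finset.mem_product.mp hz).1
    exact hf n
  · intro n y hy
    have hy' : AddMonoidAlgebra.single n y ∈ Algebra.adjoin Γ(X, U) (t : Set _) := by
      rw [ht]
      intro n'
      rw [AddMonoidAlgebra.coeff_single, Finsupp.single_apply]
      split_ifs with h
      · exact h ▸ hy
      · exact zero_mem _
    have := coeff_mem_monomialIdeal (m := m) (x := x) ?_ hy' n
    · simpa using this
    · intro f hf n
      by_cases hn : f.coeff n = 0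
      · rw [hn]; exact zero_mem _
      · have hz : (f, n) ∈ t ×ˢ t.biUnion fun f => f.coeff.support :=
          Finset.mem_product.mpr
            ⟨hf, Finset.mem_biUnion.mpr ⟨f, hf, Finsupp.mem_support_iff.mpr hn⟩⟩
        refine Ideal.subset_span ⟨Pi.single ⟨(f, n), hz⟩ 1, ?_, ?_⟩
        · rw [Finset.sum_eq_single ⟨(f, n), hz⟩]
          · simp [m]
          · intro b _ hb; simp [hb]
          · simp
        · rw [Finset.prod_eq_single ⟨(f, n), hz⟩]
          · simp [x]
          · intro b _ hb; simp [hb]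
          · simp

/-- Moving `k` along `-c` until it meets the boundary of the orthant, with denominators cleared:
`j₀` is the index at which the first coordinate vanishes. -/
theorem exists_ratio_min {ι : Type*} [Finite ι] {k : ι → ℝ} (hk : ∀ j, 0 ≤ k j) {c : ι → ℤ}
    (hc : ∃ j, 0 < c j) : ∃ j₀, 0 < c j₀ ∧ ∀ j, k j₀ * c j ≤ c j₀ * k j := by
  classical
  have := Fintype.ofFinite ι
  obtain ⟨j₀, hj₀, hmin⟩ := Finset.exists_min_image (Finset.univ.filter fun j => 0 < c j)
    (fun j => k j / c j) (by simpa [Finset.Nonempty] using hc)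
  simp only [Finset.mem_filter, Finset.mem_univ, true_and] at hj₀ hmin
  have h0 : (0 : ℝ) < c j₀ := by exact_mod_cast hj₀
  refine ⟨j₀, hj₀, fun j => ?_⟩
  rcases lt_or_ge 0 (c j) with h | h
  · have h' : (0 : ℝ) < c j := by exact_mod_cast h
    have := hmin j h
    rw [div_le_div_iff₀ h0 h'] at this
    linarith
  · have h' : (c j : ℝ) ≤ 0 := by exact_mod_cast h
    exact (mul_nonpos_of_nonneg_of_nonpos (hk j₀) h').trans (mul_nonneg h0.le (hk j))

/-- Subtracting from a multiple of the exponent `k` a multiple of a relation `c` supported on the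
support of `k` yields an exponent with smaller support. -/
theorem exists_reduction {ι N : Type*} [Fintype ι] [AddCommGroup N] {m : ι → N} {k : ι → ℕ}
    {c : ι → ℤ} (hck : ∀ j, c j ≠ 0 → k j ≠ 0) (hc : ∃ j, 0 < c j) (hcm : ∑ j, c j • m j = 0) :
    ∃ (r b : ℕ) (k' : ι → ℕ), 0 < r ∧ 0 < b ∧ (∀ j, (k' j : ℤ) = r * k j - b * c j) ∧
      {j | k' j ≠ 0} ⊂ {j | k j ≠ 0} ∧ ∑ j, k' j • m j = r • ∑ j, k j • m j := by
  obtain ⟨j₀, hj₀, hmin⟩ := exists_ratio_min (k := fun j => (k j : ℝ)) (fun j => by positivity) hc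
  obtain ⟨r, hr⟩ := Int.eq_ofNat_of_zero_le hj₀.le
  have hmin' : ∀ j, (k j₀ : ℤ) * c j ≤ c j₀ * k j := fun j => by exact_mod_cast hmin j
  have hk' : ∀ j, (((r * k j - k j₀ * c j : ℤ).toNat : ℕ) : ℤ) = r * k j - k j₀ * c j := by
    intro j
    have := hmin' j
    rw [hr] at this
    exact Int.toNat_of_nonneg (by simpa using this)
  refine ⟨r, k j₀, fun j => (r * k j - k j₀ * c j : ℤ).toNat, by omega,
    Nat.pos_of_ne_zero (hck j₀ hj₀.ne'), hk', ?_, ?_⟩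
  · rw [Set.ssubset_iff_of_subset]
    · exact ⟨j₀, hck j₀ hj₀.ne', by simp [hr, mul_comm]⟩
    · intro j hj hkj
      have : c j = 0 := by
        by_contra h
        exact hck j h hkj
      simp [hkj, this] at hj
  · have h1 : ∀ j, (r * k j - k j₀ * c j : ℤ).toNat • m j
        = r • k j • m j - (k j₀ : ℤ) • c j • m j := by
      intro j
      rw [← natCast_zsmul, hk', sub_smul, mul_smul, mul_smul, natCast_zsmul, natCast_zsmul]
    rw [Finset.sum_congr rfl fun j _ => h1 j, Finset.sum_sub_distrib, ← Finset.smul_sum,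
      ← Finset.smul_sum, hcm, smul_zero, sub_zero]

theorem exists_relation_pos {ι N : Type*} [Fintype ι] [AddCommGroup N] {m : ι → N} {J : Set ι}
    (h : ¬ LinearIndepOn ℤ m J) :
    ∃ c : ι → ℤ, (∀ j, c j ≠ 0 → j ∈ J) ∧ (∃ j, 0 < c j) ∧ ∑ j, c j • m j = 0 := by
  rw [linearIndepOn_iff] at h
  push Not at h
  obtain ⟨l, hl, hl0, hne⟩ := h
  have hsupp : ∀ j, l j ≠ 0 → j ∈ J := fun j hj =>
    (Finsupp.mem_supported ℤ l).mp hl (Finsupp.mem_support_iff.mpr hj)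
  rw [Finsupp.linearCombination_apply, Finsupp.sum_fintype _ _ (by simp)] at hl0
  obtain ⟨j, hj⟩ := Finsupp.ne_iff.mp hne
  rcases lt_or_gt_of_ne hj with h | h
  · exact ⟨fun j => -l j, fun j hj => hsupp j (by simpa using hj), ⟨j, by simpa using h⟩,
      by simpa using hl0⟩
  · exact ⟨l, hsupp, ⟨j, h⟩, hl0⟩

/-- If every monomial of degree `q • y` with linearly independent support lies in `I ^ q`, then
every monomial of degree `q • y` has a power in the corresponding power of `I`. The exponents of
degree `y` form a polyhedron whose vertices have linearly independent support; the induction on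
the support writes a multiple of an exponent as a sum of multiples of vertices and an effective
remainder. -/
theorem exists_pow_monomial_mem {ι N : Type*} [Fintype ι] [AddCommGroup N] {m : ι → N} {x : ι → A}
    {I : Ideal A} {y : N}
    (H : ∀ (q : ℕ) (k : ι → ℕ), LinearIndepOn ℤ m {j | k j ≠ 0} → 0 < q →
      ∑ j, k j • m j = q • y → ∏ j, x j ^ k j ∈ I ^ q) (k : ι → ℕ) (q : ℕ) (hq : 0 < q)
    (hk : ∑ j, k j • m j = q • y) : ∃ n, 0 < n ∧ (∏ j, x j ^ k j) ^ n ∈ I ^ (q * n) := by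
  obtain ⟨s, hs⟩ : ∃ s, s = {j | k j ≠ 0} := ⟨_, rfl⟩
  induction s using WellFoundedLT.induction generalizing k q with
  | ind s ih =>
  by_cases hli : LinearIndepOn ℤ m {j | k j ≠ 0}
  · exact ⟨1, one_pos, by simpa using H q k hli hq hk⟩
  obtain ⟨c, hcs, hcpos, hcm⟩ := exists_relation_pos hli
  obtain ⟨r, b, k₁, hr, hb, hk₁, hss₁, hdeg₁⟩ := exists_reduction hcs hcpos hcm
  obtain ⟨n₁, hn₁, hmem₁⟩ := ih _ (hs ▸ hss₁) k₁ (r * q) (by positivity)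
    (by rw [hdeg₁, hk, mul_smul]) rfl
  by_cases hneg : ∃ j, 0 < -c j
  · obtain ⟨r', b', k₂, hr', hb', hk₂, hss₂, hdeg₂⟩ :=
      exists_reduction (m := m) (c := fun j => -c j) (fun j hj => hcs j (by simpa using hj)) hneg
        (by simpa using hcm)
    obtain ⟨n₂, hn₂, hmem₂⟩ := ih _ (hs ▸ hss₂) k₂ (r' * q) (by positivity)
      (by rw [hdeg₂, hk, mul_smul]) rfl
    -- the multiples of `c` cancel in `b' k₁ + b k₂`
    have hkk : ∀ j, b' * k₁ j + b * k₂ j = (b' * r + b * r') * k j := by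
      intro j
      zify
      rw [hk₁, hk₂]
      ring
    refine ⟨(b' * r + b * r') * (n₁ * n₂), by positivity, ?_⟩
    have e1 : (∏ j, x j ^ k j) ^ ((b' * r + b * r') * (n₁ * n₂)) =
        ((∏ j, x j ^ k₁ j) ^ n₁) ^ (b' * n₂) * ((∏ j, x j ^ k₂ j) ^ n₂) ^ (b * n₁) := by
      simp only [← Finset.prod_pow, ← pow_mul, ← Finset.prod_mul_distrib, ← pow_add]
      refine Finset.prod_congr rfl fun j _ => ?_
      congr 1
      rw [← mul_assoc (k j), mul_comm (k j), ← hkk]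
      ring
    have e2 : q * ((b' * r + b * r') * (n₁ * n₂)) =
        (r * q * n₁) * (b' * n₂) + (r' * q * n₂) * (b * n₁) := by ring
    rw [e1, e2, pow_add, pow_mul, pow_mul I (r' * q * n₂)]
    exact Ideal.mul_mem_mul (Ideal.pow_mem_pow hmem₁ _) (Ideal.pow_mem_pow hmem₂ _)
  · push Not at hneg
    have hkk : ∀ j, k₁ j + b * (c j).toNat = r * k j := by
      intro j
      zify
      rw [hk₁, Int.toNat_of_nonneg (by have := hneg j; omega)]
      ring
    refine ⟨r * n₁, by positivity, ?_⟩
    have e1 : (∏ j, x j ^ k j) ^ (r * n₁) =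
        (∏ j, x j ^ k₁ j) ^ n₁ * (∏ j, x j ^ (b * (c j).toNat)) ^ n₁ := by
      rw [← mul_pow, ← Finset.prod_mul_distrib]
      simp only [← pow_add, hkk, ← Finset.prod_pow, ← pow_mul]
      refine Finset.prod_congr rfl fun j _ => ?_
      congr 1
      ring
    rw [e1, show q * (r * n₁) = r * q * n₁ by ring]
    exact Ideal.mul_mem_right _ _ hmem₁

end Monomials

/-! ### Integral facet functionals of simplicial cones -/

section Facets

variable {N : Type*} [AddCommGroup N]

/-- `Facets m D L` says that `L` contains, for every linearly independent subfamily of `m`,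
integral functionals that cut out the cone it spans, and that `D` times any lattice point of such
a cone is a combination of the subfamily with coefficients in `ℕ`. -/
def Facets {ι : Type*} [Fintype ι] (m : ι → N) (D : ℕ) (L : Finset (N →ₗ[ℤ] ℤ)) : Prop :=
  ∀ J : Set ι, LinearIndepOn ℤ m J → ∃ L' ⊆ L, (∀ l ∈ L', ∀ j ∈ J, 0 ≤ l (m j)) ∧
    ∀ y, (∀ l ∈ L', 0 ≤ l y) → ∃ c : ι → ℕ, (∀ j ∉ J, c j = 0) ∧ ∑ j, c j • m j = D • y

theorem Facets.mono {ι : Type*} [Fintype ι] {m : ι → N} {D D' : ℕ} {L L' : Finset (N →ₗ[ℤ] ℤ)}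
    (h : Facets m D L) (hD : D ∣ D') (hL : L ⊆ L') : Facets m D' L' := by
  intro J hJ
  obtain ⟨M, hM, h1, h2⟩ := h J hJ
  refine ⟨M, hM.trans hL, h1, fun y hy => ?_⟩
  obtain ⟨c, hc, hcy⟩ := h2 y hy
  obtain ⟨k, rfl⟩ := hD
  refine ⟨fun j => k * c j, fun j hj => by simp [hc j hj], ?_⟩
  simp only [mul_smul, ← Finset.smul_sum, hcy]
  rw [← mul_smul, ← mul_smul, mul_comm]

/-- Each of the functionals in `L` has constant sign on `Y`. -/
def ConstantSigns (L : Set (N →ₗ[ℤ] ℤ)) (Y : Set N) : Prop :=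
  ∀ l ∈ L, (∀ y ∈ Y, 0 ≤ l y) ∨ ∀ y ∈ Y, l y ≤ 0

/-- If functionals have constant signs on `Y`, then the cone cut out by some of them meets `Y` in
an extreme subset. -/
theorem ConstantSigns.nonneg_of_sum {L : Set (N →ₗ[ℤ] ℤ)} {Y : Set N} (hY : ConstantSigns L Y)
    {l : N →ₗ[ℤ] ℤ} (hl : l ∈ L) {κ : Type*} [Fintype κ] {e : κ → N} {w : κ → ℝ}
    (hw : ∀ i, 0 ≤ w i) (he : ∀ i, w i ≠ 0 → e i ∈ Y) (hsum : 0 ≤ ∑ i, w i * l (e i)) {i : κ}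
    (hi : w i ≠ 0) : 0 ≤ l (e i) := by
  rcases hY l hl with h | h
  · exact h _ (he i hi)
  · have h0 : ∀ i ∈ Finset.univ, 0 ≤ -(w i * (l (e i) : ℝ)) := fun i _ => by
      rw [neg_nonneg]
      by_cases hi : w i = 0
      · simp [hi]
      · exact mul_nonpos_of_nonneg_of_nonpos (hw i) (by exact_mod_cast h _ (he i hi))
    have h1 : ∑ i, -(w i * (l (e i) : ℝ)) = 0 :=
      le_antisymm (by simpa using hsum) (Finset.sum_nonneg h0)
    have h2 := (Finset.sum_eq_zero_iff_of_nonneg h0).mp h1 i (Finset.mem_univ i)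
    have h3 : (l (e i) : ℝ) = 0 := by simpa [hi] using h2
    have : l (e i) = 0 := by exact_mod_cast h3
    exact this.ge

variable [Module.Free ℤ N] [Module.Finite ℤ N]

theorem exists_common_denominator {τ : Type*} [Finite τ] (f : τ → N →ₗ[ℤ] ℚ) :
    ∃ (D : ℕ) (g : τ → N →ₗ[ℤ] ℤ), 0 < D ∧ ∀ t y, (g t y : ℚ) = D * f t y := by
  classical
  have := Fintype.ofFinite τ
  let b := Module.Free.chooseBasis ℤ N
  let D : ℕ := ∏ t, ∏ i, (f t (b i)).den
  have hD : ∀ t i, ∃ z : ℤ, (z : ℚ) = D * f t (b i) := by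
    intro t i
    have hdvd : (f t (b i)).den ∣ D :=
      (Finset.dvd_prod_of_mem (fun i => (f t (b i)).den) (Finset.mem_univ i)).trans
        (Finset.dvd_prod_of_mem (fun t => ∏ i, (f t (b i)).den) (Finset.mem_univ t))
    obtain ⟨c, hc⟩ := hdvd
    refine ⟨c * (f t (b i)).num, ?_⟩
    have := Rat.mul_den_eq_num (f t (b i))
    rw [hc]
    push_cast
    rw [← this]
    ring
  choose z hz using hD
  refine ⟨D, fun t => b.constr ℤ (z t), ?_, fun t y => ?_⟩
  · exact Finset.prod_pos fun t _ => Finset.prod_pos fun i _ => (f t (b i)).den_pos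
  · have : (Int.castAddHom ℚ).toIntLinearMap ∘ₗ b.constr ℤ (z t) = (D : ℤ) • f t := by
      refine b.ext fun i => ?_
      simp [hz]
    have h := LinearMap.congr_fun this y
    simpa using h

/-- The cone on linearly independent lattice vectors is cut out by finitely many integral
functionals: the coordinate functionals of a linear retraction onto its span, and, with both
signs, the coordinates of the defect of that retraction. -/
theorem exists_facets_of_linearIndependent {ι : Type*} [Fintype ι] (m : ι → N) {J : Set ι}
    (hJ : LinearIndepOn ℤ m J) :
    ∃ (D : ℕ) (L : Finset (N →ₗ[ℤ] ℤ)), 0 < D ∧ (∀ l ∈ L, ∀ j ∈ J, 0 ≤ l (m j)) ∧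
      ∀ y, (∀ l ∈ L, 0 ≤ l y) →
        ∃ c : ι → ℕ, (∀ j ∉ J, c j = 0) ∧ ∑ j, c j • m j = D • y := by
  classical
  let b := Module.Free.chooseBasis ℤ N
  let I := Module.Free.ChooseBasisIndex ℤ N
  let φ : N →ₗ[ℤ] (I → ℚ) :=
    LinearMap.pi fun i => (Int.castAddHom ℚ).toIntLinearMap ∘ₗ b.coord i
  have hφ : ∀ y i, φ y i = (b.repr y i : ℚ) := fun y i => rfl
  have hφinj : Function.Injective φ := by
    intro y y' h
    refine b.repr.injective (Finsupp.ext fun i => ?_)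
    have := congrFun h i
    rw [hφ, hφ] at this
    exact_mod_cast this
  have hli : LinearIndependent ℚ fun j : J => φ (m j) := by
    rw [← LinearIndependent.iff_fractionRing ℤ ℚ]
    exact LinearIndependent.map' hJ φ (LinearMap.ker_eq_bot.mpr hφinj)
  let g : (J →₀ ℚ) →ₗ[ℚ] (I → ℚ) := Finsupp.linearCombination ℚ fun j : J => φ (m j)
  obtain ⟨h, hgh⟩ := g.exists_leftInverse_of_injective (LinearMap.ker_eq_bot.mpr hli)
  have hgh' : ∀ z, h (g z) = z := fun z => LinearMap.congr_fun hgh z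
  have hgj : ∀ j : J, g (Finsupp.single j 1) = φ (m j) := fun j => by simp [g]
  let p : J → N →ₗ[ℤ] ℚ := fun j =>
    ((Finsupp.lapply j ∘ₗ h : (I → ℚ) →ₗ[ℚ] ℚ).restrictScalars ℤ) ∘ₗ φ
  let e : I → N →ₗ[ℤ] ℚ := fun i =>
    ((LinearMap.proj i ∘ₗ (LinearMap.id - g ∘ₗ h) : (I → ℚ) →ₗ[ℚ] ℚ).restrictScalars ℤ) ∘ₗ φ
  have hp : ∀ j y, p j y = h (φ y) j := fun j y => rfl
  have he : ∀ i y, e i y = φ y i - g (h (φ y)) i := fun i y => rfl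
  obtain ⟨D, l, hD, hl⟩ := exists_common_denominator
    (Sum.elim p (Sum.elim e (fun i => -e i)) : J ⊕ (I ⊕ I) → N →ₗ[ℤ] ℚ)
  have hDq : (0 : ℚ) < D := by exact_mod_cast hD
  refine ⟨D, Finset.univ.image l, hD, ?_, ?_⟩
  · intro l' hl' j hj
    obtain ⟨t, -, rfl⟩ := Finset.mem_image.mp hl'
    have he0 : ∀ i, e i (m j) = 0 := fun i => by
      rw [he, ← hgj ⟨j, hj⟩, hgh', sub_self]
    have : (0 : ℚ) ≤ l t (m j) := by
      rw [hl]
      refine mul_nonneg hDq.le ?_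
      rcases t with j' | i | i
      · simp only [Sum.elim_inl, hp]
        rw [← hgj ⟨j, hj⟩, hgh', Finsupp.single_apply]
        split_ifs <;> simp
      · simp [he0]
      · simp [he0]
    exact_mod_cast this
  · intro y hy
    have hpos : ∀ t, 0 ≤ l t y := fun t => hy _ (Finset.mem_image_of_mem _ (Finset.mem_univ t))
    have hpos' : ∀ t, 0 ≤ (Sum.elim p (Sum.elim e (fun i => -e i)) : J ⊕ (I ⊕ I) → _) t y := by
      intro t
      have : (0 : ℚ) ≤ l t y := by exact_mod_cast hpos t
      rw [hl] at this
      exact nonneg_of_mul_nonneg_right this hDq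
    have he0 : ∀ i, φ y i = g (h (φ y)) i := by
      intro i
      have h1 := hpos' (Sum.inr (Sum.inl i))
      have h2 := hpos' (Sum.inr (Sum.inr i))
      simp only [Sum.elim_inr, Sum.elim_inl, LinearMap.neg_apply, he] at h1 h2
      linarith
    refine ⟨fun j => if hj : j ∈ J then (l (Sum.inl ⟨j, hj⟩) y).toNat else 0,
      fun j hj => by simp [hj], hφinj (funext fun i => ?_)⟩
    rw [map_sum, map_nsmul, Finset.sum_apply, Pi.smul_apply, he0]
    simp only [g]
    rw [Finsupp.linearCombination_apply, Finsupp.sum_fintype _ _ (by simp), Finset.sum_apply,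
      Finset.smul_sum]
    rw [← Finset.sum_subset (Finset.subset_univ (Finset.univ.filter (· ∈ J)))
      (by intro j _ hj; simp at hj; simp [hj]), ← Finset.sum_subtype_eq_sum_filter,
      Finset.subtype_univ]
    refine Finset.sum_congr rfl fun j _ => ?_
    have hj := j.2
    have hc : (((l (Sum.inl j) y).toNat : ℕ) : ℚ) = D * h (φ y) j := by
      have : (((l (Sum.inl j) y).toNat : ℤ) : ℚ) = l (Sum.inl j) y := by
        rw [Int.toNat_of_nonneg (hpos _)]
      rw [← hp]
      have h2 := hl (Sum.inl j) y
      rw [← this] at h2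
      exact_mod_cast h2
    simp only [hj, dite_true, map_nsmul, Pi.smul_apply, nsmul_eq_mul, Subtype.coe_eta, hc,
      smul_eq_mul]
    ring

/-- Take all functionals for the finitely many independent subfamilies, and the product of the
denominators. -/
theorem exists_facets {ι : Type*} [Fintype ι] (m : ι → N) :
    ∃ (D : ℕ) (L : Finset (N →ₗ[ℤ] ℤ)), 0 < D ∧ Facets m D L := by
  classical
  choose! D L hD h1 h2 using fun (J : Set ι) (hJ : LinearIndepOn ℤ m J) =>
    exists_facets_of_linearIndependent m hJ
  let 𝒥 : Finset (Set ι) := Finset.univ.filter fun J => LinearIndepOn ℤ m J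
  refine ⟨∏ J ∈ 𝒥, D J, 𝒥.biUnion L, Finset.prod_pos fun J hJ => hD J ?_, fun J hJ => ?_⟩
  · exact (Finset.mem_filter.mp hJ).2
  have hmem : J ∈ 𝒥 := Finset.mem_filter.mpr ⟨Finset.mem_univ _, hJ⟩
  obtain ⟨k, hk⟩ := Finset.dvd_prod_of_mem D hmem
  refine ⟨L J, Finset.subset_biUnion_of_mem L hmem, h1 J hJ, fun y hy => ?_⟩
  obtain ⟨c, hc, hcy⟩ := h2 J hJ y hy
  refine ⟨fun j => k * c j, fun j hj => by simp [hc j hj], ?_⟩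
  simp only [mul_smul, ← Finset.smul_sum, hcy]
  rw [← mul_smul, hk, mul_comm]

end Facets

/-! ### Linearity of the integral closures on cells of constant signs -/

section Linearity

variable {A : Type*} [CommRing A] {N : Type*} [AddCommGroup N] {S : AddSubmonoid N}

theorem pow_le_of_mul_le {𝔞 : S → Ideal A} (h0 : 𝔞 0 = ⊤) (hmul : ∀ n n', 𝔞 n * 𝔞 n' ≤ 𝔞 (n + n'))
    (n : S) (k : ℕ) : 𝔞 n ^ k ≤ 𝔞 (k • n) := by
  induction k with
  | zero => simp [h0]
  | succ k ih =>
    rw [pow_succ, succ_nsmul]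
    exact (Ideal.mul_mono_left ih).trans (hmul _ _)

theorem prod_le_of_mul_le {𝔞 : S → Ideal A} (h0 : 𝔞 0 = ⊤)
    (hmul : ∀ n n', 𝔞 n * 𝔞 n' ≤ 𝔞 (n + n')) {κ : Type*} (s : Finset κ) (n : κ → S) :
    ∏ i ∈ s, 𝔞 (n i) ≤ 𝔞 (∑ i ∈ s, n i) := by
  classical
  induction s using Finset.induction_on with
  | empty => simp [h0]
  | insert i s hi ih =>
    rw [Finset.prod_insert hi, Finset.sum_insert hi]
    exact (Ideal.mul_mono_right ih).trans (hmul _ _)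

/-- On lattice points of a set where the facet functionals have constant signs, the integral
closures of the `d`-th multiples of a graded system are multiplicative. -/
theorem integralClosure_eq_prod {𝔞 : S → Ideal A} (h0 : 𝔞 0 = ⊤)
    (hmul : ∀ n n', 𝔞 n * 𝔞 n' ≤ 𝔞 (n + n')) {ι : Type*} [Fintype ι] {m : ι → S} {x : ι → A}
    (hx : ∀ j, x j ∈ 𝔞 (m j)) (hgen : ∀ n, 𝔞 n ≤ monomialIdeal m x n)
    {d : ℕ} (hd : 0 < d) {L : Finset (N →ₗ[ℤ] ℤ)} (hL : Facets (fun j => (m j : N)) d L)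
    {Y : Set N} (hY : ConstantSigns L Y) {κ : Type*} [Fintype κ] {e : κ → S}
    (he : ∀ i, (e i : N) ∈ Y) (p : κ → ℕ) :
    integralClosure (𝔞 (d • ∑ i, p i • e i)) = integralClosure (∏ i, 𝔞 (d • e i) ^ p i) := by
  apply le_antisymm
  · refine integralClosure_le_integralClosure ((hgen _).trans ?_)
    rw [monomialIdeal, Ideal.span_le]
    rintro _ ⟨k, hk, rfl⟩
    suffices H : ∀ (q : ℕ) (k : ι → ℕ), LinearIndepOn ℤ (fun j => (m j : N)) {j | k j ≠ 0} →
        0 < q → ∑ j, k j • (m j : N) = q • ((d • ∑ i, p i • e i : S) : N) →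
        ∏ j, x j ^ k j ∈ (∏ i, 𝔞 (d • e i) ^ p i) ^ q by
      obtain ⟨n, hn, hmem⟩ := exists_pow_monomial_mem H k 1 one_pos (by rw [one_smul, ← hk]; simp)
      exact isIntegralOverIdeal_of_pow_mem hn (by simpa using hmem)
    clear k hk
    intro q k hli hq hk
    obtain ⟨L', hL', hpos, hcut⟩ := hL _ hli
    -- the generators `e i` that occur lie in the cone on the support of `k`
    have hc : ∀ i, ∃ c : ι → ℕ, p i ≠ 0 →
        (∀ j, k j = 0 → c j = 0) ∧ ∑ j, c j • (m j : N) = d • (e i : N) := by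
      intro i
      by_cases hi : p i = 0
      · exact ⟨0, fun h => absurd hi h⟩
      obtain ⟨c, hc, hcs⟩ := hcut (e i) fun l hl => by
        refine hY.nonneg_of_sum (hL' hl) (e := fun i => (e i : N)) (w := fun i => (p i : ℝ))
          (fun i => by positivity) (fun i _ => he i) ?_ (i := i) (by exact_mod_cast hi)
        have h1 : 0 ≤ l (q • ((d • ∑ i, p i • e i : S) : N)) := by
          rw [← hk, map_sum]
          refine Finset.sum_nonneg fun j _ => ?_
          rw [map_nsmul]
          by_cases hj : k j = 0
          · simp [hj]
          · exact nsmul_nonneg (hpos l hl j hj) _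
        have h2 : l (q • ((d • ∑ i, p i • e i : S) : N)) =
            (q * d : ℕ) * ∑ i, (p i : ℤ) * l (e i) := by
          simp [mul_assoc]
        rw [h2] at h1
        have h3 : 0 ≤ ∑ i, (p i : ℤ) * l (e i) :=
          nonneg_of_mul_nonneg_right h1 (by exact_mod_cast Nat.mul_pos hq hd)
        exact_mod_cast h3
      exact ⟨c, fun _ => ⟨fun j hj => hc j (by simpa using hj), hcs⟩⟩
    choose c hc using hc
    have hk' : ∀ j, k j = ∑ i, q * p i * c i j := by
      have h1 : ∑ j, (k j : ℤ) • (m j : N) = ∑ j, ((∑ i, q * p i * c i j : ℕ) : ℤ) • (m j : N) := by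
        simp only [natCast_zsmul]
        rw [hk]
        simp only [Finset.sum_smul]
        rw [Finset.sum_comm]
        simp only [AddSubmonoidClass.coe_nsmul, AddSubmonoid.coe_finsetSum, Finset.smul_sum]
        refine Finset.sum_congr rfl fun i _ => ?_
        by_cases hi : p i = 0
        · simp [hi]
        simp only [mul_smul, ← Finset.smul_sum, (hc i hi).2]
        congr 1
        rw [← mul_smul, ← mul_smul, mul_comm]
      rw [linearIndepOn_iff'] at hli
      have h2 := hli (Finset.univ.filter fun j => k j ≠ 0)
        (fun j => (k j : ℤ) - ((∑ i, q * p i * c i j : ℕ) : ℤ)) (by simp) ?_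
      · intro j
        by_cases hj : k j = 0
        · rw [hj]
          symm
          refine Finset.sum_eq_zero fun i _ => ?_
          by_cases hi : p i = 0
          · simp [hi]
          · simp [(hc i hi).1 j hj]
        · have := h2 j (by simpa using hj)
          omega
      · rw [Finset.sum_filter_of_ne]
        · simp only [sub_smul, Finset.sum_sub_distrib]
          rw [h1, sub_self]
        · intro j _ hj hkj
          apply hj
          have : ∑ i, q * p i * c i j = 0 := by
            refine Finset.sum_eq_zero fun i _ => ?_
            by_cases hi : p i = 0
            · simp [hi]
            · simp [(hc i hi).1 j hkj]
          rw [this, hkj]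
          simp
    have hprod : ∏ j, x j ^ k j = ∏ i, ((∏ j, x j ^ c i j) ^ p i) ^ q := by
      simp only [hk', ← Finset.prod_pow_eq_pow_sum, ← Finset.prod_pow, ← pow_mul]
      rw [Finset.prod_comm]
      refine Finset.prod_congr rfl fun i _ => Finset.prod_congr rfl fun j _ => ?_
      congr 1
      ring
    rw [hprod, ← Finset.prod_pow]
    refine Ideal.prod_mem_prod fun i _ => Ideal.pow_mem_pow ?_ q
    by_cases hi : p i = 0
    · simp [hi]
    refine Ideal.pow_mem_pow ?_ _
    have hdeg : ∑ j, c i j • m j = d • e i := Subtype.ext (by simpa using (hc i hi).2)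
    rw [← hdeg]
    exact (prod_le_of_mul_le h0 hmul _ _) (Ideal.prod_mem_prod fun j _ =>
      pow_le_of_mul_le h0 hmul _ _ (Ideal.pow_mem_pow (hx j) _))
  · refine integralClosure_le_integralClosure (le_trans ?_ (le_integralClosure _))
    refine (Finset.prod_le_prod' fun i _ => pow_le_of_mul_le h0 hmul (d • e i) (p i)).trans
      ((prod_le_of_mul_le h0 hmul _ _).trans (le_of_eq ?_))
    congr 1
    rw [Finset.smul_sum]
    exact Finset.sum_congr rfl fun i _ => smul_comm _ _ _

end Linearity

/-! ### Cones on sets of lattice vectors -/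

section Cones

variable {N : Type u} [AddCommGroup N]

/-- The formal real combination `a` of lattice vectors, evaluated in `N_ℝ`. -/
noncomputable def realize : (N →₀ ℝ) →ₗ[ℝ] RealSpan N :=
  Finsupp.linearCombination ℝ (toReal N)

theorem realize_single (y : N) (c : ℝ) : realize (Finsupp.single y c) = c • toReal N y := by
  simp [realize]

/-- The real extension of an integral functional. -/
noncomputable def realFunctional (l : N →ₗ[ℤ] ℤ) : RealSpan N →ₗ[ℝ] ℝ :=
  (TensorProduct.AlgebraTensorModule.rid ℤ ℝ ℝ).toLinearMap ∘ₗ l.baseChange ℝ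

theorem realFunctional_toReal (l : N →ₗ[ℤ] ℤ) (y : N) :
    realFunctional l (toReal N y) = l y := by
  simp [realFunctional, toReal]

theorem realFunctional_realize (l : N →ₗ[ℤ] ℤ) (a : N →₀ ℝ) :
    realFunctional l (realize a) = a.sum fun y c => c * l y := by
  rw [realize, Finsupp.linearCombination_apply, map_finsuppSum]
  simp [realFunctional_toReal]

theorem toReal_mem_coneOf {T : Set N} {y : N} (hy : y ∈ T) : toReal N y ∈ coneOf T :=
  PointedCone.subset_hull (Set.mem_image_of_mem _ hy)

theorem realize_mem_of_forall {σ : PointedCone ℝ (RealSpan N)} {a : N →₀ ℝ} (ha : ∀ y, 0 ≤ a y)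
    (h : ∀ y, a y ≠ 0 → toReal N y ∈ σ) : realize a ∈ σ := by
  rw [realize, Finsupp.linearCombination_apply]
  exact sum_mem fun y hy => σ.smul_mem (ha y) (h y (Finsupp.mem_support_iff.mp hy))

theorem mem_coneOf {T : Set N} {x : RealSpan N} :
    x ∈ coneOf T ↔ ∃ a : N →₀ ℝ, (∀ y, 0 ≤ a y) ∧ (∀ y, a y ≠ 0 → y ∈ T) ∧ realize a = x := by
  constructor
  · intro hx
    rw [coneOf, PointedCone.hull] at hx
    induction hx using Submodule.span_induction with
    | mem x hx =>
      classical
      obtain ⟨y, hy, rfl⟩ := hx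
      refine ⟨Finsupp.single y 1, fun z => ?_, fun z hz => ?_, by simp [realize_single]⟩
      · rw [Finsupp.single_apply]; split_ifs <;> norm_num
      · rw [Finsupp.single_apply] at hz
        split_ifs at hz with h
        · exact h ▸ hy
        · exact absurd rfl hz
    | zero => exact ⟨0, by simp, by simp, by simp⟩
    | add x x' _ _ h h' =>
      obtain ⟨a, h1, h2, rfl⟩ := h
      obtain ⟨a', h1', h2', rfl⟩ := h'
      refine ⟨a + a', fun y => add_nonneg (h1 y) (h1' y), fun y hy => ?_, map_add _ _ _⟩
      by_cases h : a y = 0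
      · exact h2' y (by simpa [h] using hy)
      · exact h2 y h
    | smul c x _ h =>
      obtain ⟨a, h1, h2, rfl⟩ := h
      refine ⟨(c : ℝ) • a, fun y => mul_nonneg c.2 (h1 y), fun y hy => h2 y ?_, map_smul _ _ _⟩
      intro h
      simp [h] at hy
  · rintro ⟨a, h1, h2, rfl⟩
    exact realize_mem_of_forall h1 fun y hy => toReal_mem_coneOf (h2 y hy)

theorem coneOf_le_iff {T : Set N} {σ : PointedCone ℝ (RealSpan N)} :
    coneOf T ≤ σ ↔ ∀ y ∈ T, toReal N y ∈ σ := by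
  rw [coneOf, PointedCone.hull, Submodule.span_le, Set.image_subset_iff]
  rfl

theorem toReal_mem_coneOf_closure {T : Set N} {y : N} (hy : y ∈ AddSubmonoid.closure T) :
    toReal N y ∈ coneOf T := by
  have : AddSubmonoid.closure T ≤ latticePoints (coneOf T) :=
    AddSubmonoid.closure_le.mpr fun z hz => toReal_mem_coneOf hz
  exact this hy

/-- A functional of constant sign on `T` has the same sign on the lattice points of the cone on
`T`. -/
theorem ConstantSigns.latticePoints {L : Set (N →ₗ[ℤ] ℤ)} {T : Set N} (h : ConstantSigns L T) :
    ConstantSigns L {y | toReal N y ∈ coneOf T} := by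
  have key : ∀ l : N →ₗ[ℤ] ℤ, (∀ y ∈ T, 0 ≤ l y) → ∀ y, toReal N y ∈ coneOf T → 0 ≤ l y := by
    intro l hl y hy
    obtain ⟨a, ha, haT, hay⟩ := mem_coneOf.mp hy
    have h1 : (0 : ℝ) ≤ l y := by
      rw [← realFunctional_toReal, ← hay, realFunctional_realize]
      refine Finset.sum_nonneg fun z hz => mul_nonneg (ha z) ?_
      exact_mod_cast hl z (haT z (Finsupp.mem_support_iff.mp hz))
    exact_mod_cast h1
  intro l hl
  rcases h l hl with h | h
  · exact Or.inl (key l h)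
  · refine Or.inr fun y hy => ?_
    have := key (-l) (fun z hz => by simpa using h z hz) y hy
    simpa using this

/-- Carathéodory's theorem for cones on lattice vectors. -/
theorem exists_linearIndepOn_of_mem_coneOf {ι : Type*} [Fintype ι] (m : ι → N) {x : RealSpan N}
    (hx : x ∈ coneOf (Set.range m)) :
    ∃ k : ι → ℝ, (∀ j, 0 ≤ k j) ∧ LinearIndepOn ℤ m {j | k j ≠ 0} ∧
      ∑ j, k j • toReal N (m j) = x := by
  obtain ⟨k, hk, hkx⟩ : ∃ k : ι → ℝ, (∀ j, 0 ≤ k j) ∧ ∑ j, k j • toReal N (m j) = x := by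
    rw [coneOf, ← Set.range_comp, PointedCone.hull, Submodule.mem_span_range_iff_exists_fun] at hx
    obtain ⟨c, hc⟩ := hx
    exact ⟨fun j => c j, fun j => (c j).2, hc⟩
  obtain ⟨s, hs⟩ : ∃ s, s = {j | k j ≠ 0} := ⟨_, rfl⟩
  induction s using WellFoundedLT.induction generalizing k with
  | ind s ih =>
  by_cases hli : LinearIndepOn ℤ m {j | k j ≠ 0}
  · exact ⟨k, hk, hli, hkx⟩
  obtain ⟨c, hcs, hcpos, hcm⟩ := exists_relation_pos hli
  obtain ⟨j₀, hj₀, hmin⟩ := exists_ratio_min hk hcpos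
  have h0 : (0 : ℝ) < c j₀ := by exact_mod_cast hj₀
  refine ih _ ?_ (fun j => k j - k j₀ / c j₀ * c j) (fun j => ?_) ?_ rfl
  · rw [hs]
    refine (Set.ssubset_iff_of_subset fun j hj hkj => ?_).mpr ⟨j₀, hcs j₀ hj₀.ne', ?_⟩
    · have : c j = 0 := by
        by_contra h
        exact hcs j h hkj
      simp [hkj, this] at hj
    · simp [h0.ne']
  · have := hmin j
    rw [sub_nonneg, div_mul_eq_mul_div, div_le_iff₀ h0]
    linarith
  · have h1 : ∑ j, (c j : ℝ) • toReal N (m j) = 0 := by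
      have := congrArg (toReal N) hcm
      rw [map_sum, map_zero] at this
      simpa [Int.cast_smul_eq_zsmul] using this
    simp only [sub_smul, mul_smul, Finset.sum_sub_distrib, ← Finset.smul_sum, h1, hkx, smul_zero,
      sub_zero]

end Cones

/-! ### Simplicial complexes of lattice vectors -/

/-- A smooth fan in `N_ℝ`, recorded by the sets of primitive generators of its cones: a finite
simplicial complex on vectors of `N` each of whose faces is part of a basis of `N`, and whose
geometric realization (the nonnegative functions supported on a face) maps injectively
to `N_ℝ`. -/
structure SmoothComplex (N : Type u) [AddCommGroup N] where
  /-- The faces of the complex. -/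
  faces : Finset (Finset N)
  down_closed : ∀ F ∈ faces, ∀ G ⊆ F, G ∈ faces
  exists_basis : ∀ F ∈ faces, ∃ b : Module.Basis (Fin (Module.finrank ℤ N)) ℤ N,
    (F : Set N) ⊆ Set.range b
  realize_inj : ∀ F ∈ faces, ∀ G ∈ faces, ∀ a a' : N →₀ ℝ, (∀ y, 0 ≤ a y) → (∀ y, 0 ≤ a' y) →
    (∀ y, a y ≠ 0 → y ∈ F) → (∀ y, a' y ≠ 0 → y ∈ G) → realize a = realize a' → a = a'

namespace SmoothComplex

variable {N : Type u} [AddCommGroup N]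

/-- The cones of the complex cover `N_ℝ`. -/
def IsComplete (K : SmoothComplex N) : Prop :=
  ∀ x : RealSpan N, ∃ F ∈ K.faces, x ∈ coneOf (F : Set N)

/-- The functional `l` has constant sign on each cone of the complex. -/
def ConstantSign (K : SmoothComplex N) (l : N →ₗ[ℤ] ℤ) : Prop :=
  ∀ F ∈ K.faces, (∀ y ∈ F, 0 ≤ l y) ∨ ∀ y ∈ F, l y ≤ 0

theorem isFaceOf_of_subset (K : SmoothComplex N) {F G : Finset N} (hF : F ∈ K.faces) (hG : G ⊆ F) :
    (coneOf (G : Set N)).IsFaceOf (coneOf (F : Set N)) where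
  le := coneOf_le_iff.mpr fun y hy => toReal_mem_coneOf (hG hy)
  mem_of_smul_add_mem := by
    intro x y c hx hy hc hxy
    obtain ⟨a, ha, haF, rfl⟩ := mem_coneOf.mp hx
    obtain ⟨a', ha', haF', rfl⟩ := mem_coneOf.mp hy
    obtain ⟨a'', ha'', haG, h⟩ := mem_coneOf.mp hxy
    have heq : a'' = c • a + a' := by
      refine K.realize_inj F hF F hF _ _ ha''
        (fun z => add_nonneg (mul_nonneg hc.le (ha z)) (ha' z)) (fun z hz => hG (haG z hz))
        (fun z hz => ?_) (by rw [h, map_add, map_smul])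
      by_cases h : a z = 0
      · exact haF' z (by simpa [h] using hz)
      · exact haF z h
    refine mem_coneOf.mpr ⟨a, ha, fun z hz => haG z ?_, rfl⟩
    have h1 : 0 < a z := lt_of_le_of_ne (ha z) (Ne.symm hz)
    have h2 : 0 < c * a z + a' z := add_pos_of_pos_of_nonneg (mul_pos hc h1) (ha' z)
    rw [heq]
    exact h2.ne'

/-- A face of the cone on `F` is generated by the vectors of `F` that it contains. -/
theorem eq_coneOf_of_isFaceOf {F : Finset N} {τ : PointedCone ℝ (RealSpan N)}
    (h : τ.IsFaceOf (coneOf (F : Set N))) :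
    τ = coneOf {y | y ∈ F ∧ toReal N y ∈ τ} := by
  apply le_antisymm
  · intro x hx
    obtain ⟨a, ha, haF, rfl⟩ := mem_coneOf.mp (h.le hx)
    refine mem_coneOf.mpr ⟨a, ha, fun y hy => ⟨haF y hy, ?_⟩, rfl⟩
    refine h.mem_of_smul_add_mem (toReal_mem_coneOf (haF y hy))
      (y := realize (a.erase y)) (mem_coneOf.mpr ⟨_, fun z => ?_, fun z hz => haF z ?_, rfl⟩)
      (lt_of_le_of_ne (ha y) (Ne.symm hy)) ?_
    · classical
      rw [Finsupp.erase_apply]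
      split_ifs
      · exact le_rfl
      · exact ha z
    · classical
      rw [Finsupp.erase_apply] at hz
      split_ifs at hz
      · exact absurd rfl hz
      · exact hz
    · rw [← realize_single, ← map_add, Finsupp.single_add_erase]
      exact hx
  · exact coneOf_le_iff.mpr fun y hy => hy.2

theorem coneOf_inf_coneOf [DecidableEq N] (K : SmoothComplex N) {F G : Finset N}
    (hF : F ∈ K.faces) (hG : G ∈ K.faces) :
    coneOf (F : Set N) ⊓ coneOf (G : Set N) = coneOf ((F ∩ G : Finset N) : Set N) := by
  apply le_antisymm
  · rintro x ⟨hx, hx'⟩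
    obtain ⟨a, ha, haF, rfl⟩ := mem_coneOf.mp hx
    obtain ⟨a', ha', haG, h⟩ := mem_coneOf.mp hx'
    obtain rfl := K.realize_inj G hG F hF _ _ ha' ha haG haF h
    exact mem_coneOf.mpr ⟨a', ha, fun y hy => by simp [haF y hy, haG y hy], rfl⟩
  · refine le_inf ?_ ?_ <;> refine coneOf_le_iff.mpr fun y hy => toReal_mem_coneOf ?_
    · exact Finset.inter_subset_left hy
    · exact Finset.inter_subset_right hy

/-- The fan of the cones on the faces of a smooth complex. -/
noncomputable def toFan (K : SmoothComplex N) : Fan N where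
  cones := (fun F : Finset N => coneOf (F : Set N)) '' (K.faces : Set (Finset N))
  finite := (Finset.finite_toSet _).image _
  rational := by
    rintro _ ⟨F, -, rfl⟩
    exact ⟨F, F.finite_toSet, rfl⟩
  stronglyConvex := by
    rintro _ ⟨F, hF, rfl⟩ x hx hx'
    obtain ⟨a, ha, haF, rfl⟩ := mem_coneOf.mp hx
    obtain ⟨a', ha', haF', h⟩ := mem_coneOf.mp hx'
    have h0 : a + a' = 0 := by
      refine K.realize_inj F hF F hF _ _ (fun z => add_nonneg (ha z) (ha' z)) (by simp)
        (fun z hz => ?_) (by simp) (by rw [map_add, h, map_zero, add_neg_cancel])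
      by_cases h : a z = 0
      · exact haF' z (by simpa [h] using hz)
      · exact haF z h
    have : a = 0 := by
      ext z
      have h1 : a z + a' z = 0 := DFunLike.congr_fun h0 z
      have := ha z
      have := ha' z
      simp only [Finsupp.coe_zero, Pi.zero_apply]
      linarith
    rw [this, map_zero]
  face_mem := by
    classical
    rintro _ ⟨F, hF, rfl⟩ τ hτ
    refine ⟨F.filter fun y => toReal N y ∈ τ, K.down_closed F hF _ (Finset.filter_subset _ _), ?_⟩
    dsimp only
    rw [Finset.coe_filter]
    exact (eq_coneOf_of_isFaceOf hτ).symm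
  inf_isFaceOf := by
    classical
    rintro _ ⟨F, hF, rfl⟩ _ ⟨G, hG, rfl⟩
    dsimp only
    rw [K.coneOf_inf_coneOf hF hG]
    exact ⟨K.isFaceOf_of_subset hF Finset.inter_subset_left,
      K.isFaceOf_of_subset hG Finset.inter_subset_right⟩

theorem mem_cones_toFan {K : SmoothComplex N} {σ : PointedCone ℝ (RealSpan N)} :
    σ ∈ K.toFan.cones ↔ ∃ F ∈ K.faces, coneOf (F : Set N) = σ := Iff.rfl

theorem isSmooth_toFan (K : SmoothComplex N) : K.toFan.IsSmooth := by
  rintro _ ⟨F, hF, rfl⟩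
  obtain ⟨b, hb⟩ := K.exists_basis F hF
  exact ⟨b, b ⁻¹' F, by rw [Set.image_preimage_eq_of_subset hb]⟩

open scoped Classical in
/-- The subcomplex of the faces contained in `T`. -/
noncomputable def restrict (K : SmoothComplex N) (T : Set N) : SmoothComplex N where
  faces := K.faces.filter fun F => (F : Set N) ⊆ T
  down_closed := by
    intro F hF G hG
    simp only [Finset.mem_filter] at hF ⊢
    exact ⟨K.down_closed F hF.1 G hG, (Finset.coe_subset.mpr hG).trans hF.2⟩
  exists_basis := by
    intro F hF
    simp only [Finset.mem_filter] at hF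
    exact K.exists_basis F hF.1
  realize_inj := by
    intro F hF G hG
    simp only [Finset.mem_filter] at hF hG
    exact K.realize_inj F hF.1 G hG.1

theorem mem_faces_restrict {K : SmoothComplex N} {T : Set N} {F : Finset N} :
    F ∈ (K.restrict T).faces ↔ F ∈ K.faces ∧ (F : Set N) ⊆ T := by
  simp only [restrict, Finset.mem_filter]

end SmoothComplex

namespace SmoothComplex

variable {N : Type u} [AddCommGroup N]

/-! ### Subdividing an edge -/

section Subdivision

/-- Replacing one vector of a basis by its sum with another one gives a basis. -/
theorem exists_basis_insert_add [DecidableEq N] {r : ℕ} (b : Module.Basis (Fin r) ℤ N) {u v : N}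
    (hne : u ≠ v) (hu : u ∈ Set.range b) (hv : v ∈ Set.range b) {G : Finset N} (huG : u ∉ G)
    (hG : (G : Set N) ⊆ Set.range b) :
    ∃ b' : Module.Basis (Fin r) ℤ N, ((insert (u + v) G : Finset N) : Set N) ⊆ Set.range b' := by
  obtain ⟨i, rfl⟩ := hu
  obtain ⟨j, rfl⟩ := hv
  have hij : j ≠ i := fun h => hne (h ▸ rfl)
  have h0 : b.coord i (b j) = 0 := by simp [hij]
  refine ⟨b.map (LinearEquiv.transvection h0), ?_⟩
  rw [Finset.coe_insert, Set.insert_subset_iff]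
  refine ⟨⟨i, ?_⟩, fun y hy => ?_⟩
  · rw [Module.Basis.map_apply, LinearEquiv.transvection.apply]
    simp
  · obtain ⟨k, rfl⟩ := hG hy
    have hki : k ≠ i := fun h => huG (h ▸ hy)
    refine ⟨k, ?_⟩
    rw [Module.Basis.map_apply, LinearEquiv.transvection.apply]
    simp [hki]

theorem ne_zero_of_mem {K : SmoothComplex N} {F : Finset N} (hF : F ∈ K.faces) {u : N}
    (hu : u ∈ F) : u ≠ 0 := by
  obtain ⟨b, hb⟩ := K.exists_basis F hF
  obtain ⟨i, rfl⟩ := hb hu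
  exact b.ne_zero i

theorem single_add_single_nonneg {M : Type*} (u v y : M) :
    0 ≤ (Finsupp.single u (1 : ℝ) + Finsupp.single v 1 : M →₀ ℝ) y := by
  classical
  simp only [Finsupp.add_apply, Finsupp.single_apply]
  split_ifs <;> norm_num

/-- A formal combination supported on the subdivided complex, rewritten on the original one by
moving the coefficient of `u + v` to `u` and `v`. -/
noncomputable def coarsen (u v : N) (a : N →₀ ℝ) : N →₀ ℝ :=
  a + a (u + v) • (Finsupp.single u 1 + Finsupp.single v 1 - Finsupp.single (u + v) 1)

theorem realize_coarsen (u v : N) (a : N →₀ ℝ) : realize (coarsen u v a) = realize a := by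
  simp [coarsen, realize_single]

variable [DecidableEq N]

/-- The faces of the subdivision of the edge `{u, v}` by `u + v`: the faces that do not contain
the edge, and the joins of `u + v` with such faces in the star of the edge. -/
def subdivideFaces (K : SmoothComplex N) (u v : N) : Finset (Finset N) :=
  (K.faces.filter fun F => ¬(u ∈ F ∧ v ∈ F)) ∪
    (K.faces.filter fun G => ¬(u ∈ G ∧ v ∈ G) ∧ insert u (insert v G) ∈ K.faces).image
      (insert (u + v))

theorem mem_subdivideFaces {K : SmoothComplex N} {u v : N} {F : Finset N} :
    F ∈ K.subdivideFaces u v ↔ (F ∈ K.faces ∧ ¬(u ∈ F ∧ v ∈ F)) ∨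
      ∃ G ∈ K.faces, ¬(u ∈ G ∧ v ∈ G) ∧ insert u (insert v G) ∈ K.faces ∧
        insert (u + v) G = F := by
  simp [subdivideFaces, and_assoc]

/-- The vertex `u + v` of the subdivision is new: otherwise it would have two expressions as a
point of the realization. -/
theorem add_notMem {K : SmoothComplex N} {u v : N} (huv : {u, v} ∈ K.faces) {F : Finset N}
    (hF : F ∈ K.faces) : u + v ∉ F := by
  intro hw
  have hu : u ≠ 0 := ne_zero_of_mem huv (by simp)
  have hv : v ≠ 0 := ne_zero_of_mem huv (by simp)
  have h := K.realize_inj F hF _ huv (Finsupp.single (u + v) 1)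
    (Finsupp.single u 1 + Finsupp.single v 1) (fun y => ?_) (single_add_single_nonneg u v)
    (fun y hy => ?_) (fun y hy => ?_) (by simp [realize_single])
  · have := DFunLike.congr_fun h (u + v)
    simp [hu, hv] at this
  · rw [Finsupp.single_apply]; split_ifs <;> norm_num
  · rw [Finsupp.single_apply] at hy
    split_ifs at hy with h
    · exact h ▸ hw
    · exact absurd rfl hy
  · rw [Finset.mem_insert, Finset.mem_singleton]
    by_contra! hy'
    simp [hy'.1.symm, hy'.2.symm] at hy

theorem coarsen_apply (u v : N) (a : N →₀ ℝ) (y : N) : coarsen u v a y =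
    a y + a (u + v) * ((if u = y then 1 else 0) + (if v = y then 1 else 0) -
      if u + v = y then 1 else 0) := by
  simp [coarsen, Finsupp.single_apply]

/-- Coarsening maps the realization of the subdivision to that of the original complex. The last
clause makes it invertible: a face of the subdivision does not contain both `u` and `v`. -/
theorem exists_coarsen_face {K : SmoothComplex N} {u v : N}
    (huv : {u, v} ∈ K.faces) {F : Finset N} (hF : F ∈ K.subdivideFaces u v) {a : N →₀ ℝ}
    (ha : ∀ y, 0 ≤ a y) (haF : ∀ y, a y ≠ 0 → y ∈ F) :
    (∀ y, 0 ≤ coarsen u v a y) ∧ (∃ F' ∈ K.faces, ∀ y, coarsen u v a y ≠ 0 → y ∈ F') ∧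
      min (a u) (a v) = 0 := by
  have hu : u ≠ 0 := ne_zero_of_mem huv (by simp)
  have hv : v ≠ 0 := ne_zero_of_mem huv (by simp)
  have hmin : ∀ {G : Finset N}, ¬(u ∈ G ∧ v ∈ G) → (∀ y, a y ≠ 0 → y ≠ u + v → y ∈ G) →
      min (a u) (a v) = 0 := by
    intro G hG haG
    by_cases h : a u = 0
    · rw [h, min_eq_left (ha v)]
    · have h' : a v = 0 := by
        by_contra h'
        exact hG ⟨haG u h (by simpa using hv), haG v h' (by simpa using hu)⟩
      rw [h', min_eq_right (ha u)]
  have hnonneg : ∀ y, 0 ≤ coarsen u v a y := by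
    intro y
    rw [coarsen_apply]
    have h1 := ha y
    have h2 := ha (u + v)
    by_cases hy : u + v = y
    · subst hy
      simp [hu, hv]
    · simp only [hy, if_false, sub_zero]
      split_ifs <;> simp <;> linarith
  refine ⟨hnonneg, ?_⟩
  rcases mem_subdivideFaces.mp hF with ⟨hF', hF''⟩ | ⟨G, hG, hG', hst, rfl⟩
  · have hw : a (u + v) = 0 := by
      by_contra h
      exact add_notMem huv hF' (haF _ h)
    refine ⟨⟨F, hF', fun y hy => haF y ?_⟩, hmin hF'' fun y hy _ => haF y hy⟩
    simpa [coarsen_apply, hw] using hy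
  · refine ⟨⟨_, hst, fun y hy => ?_⟩, hmin hG' fun y hy hy' => ?_⟩
    · rw [Finset.mem_insert, Finset.mem_insert]
      by_contra! hy'
      obtain ⟨h1, h2, h3⟩ := hy'
      by_cases hyw : u + v = y
      · subst hyw
        simp [coarsen_apply, hu, hv] at hy
      · have h0 : a y = 0 := by
          by_contra h
          rcases Finset.mem_insert.mp (haF y h) with h | h
          · exact hyw h.symm
          · exact h3 h
        simp [coarsen_apply, h0, Ne.symm h1, Ne.symm h2, hyw] at hy
    · exact (Finset.mem_insert.mp (haF y hy)).resolve_left hy'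

/-- The star subdivision of a smooth complex at the edge `{u, v}`, with new vertex `u + v`. -/
def subdivide (K : SmoothComplex N) {u v : N} (hne : u ≠ v) (huv : {u, v} ∈ K.faces) :
    SmoothComplex N where
  faces := K.subdivideFaces u v
  down_closed := by
    intro F hF G hGF
    rcases mem_subdivideFaces.mp hF with ⟨hF', hF''⟩ | ⟨F', hF', hF'', hst, rfl⟩
    · exact mem_subdivideFaces.mpr (Or.inl
        ⟨K.down_closed F hF' G hGF, fun h => hF'' ⟨hGF h.1, hGF h.2⟩⟩)
    · by_cases hw : u + v ∈ G
      · have hsub : G.erase (u + v) ⊆ F' := Finset.subset_insert_iff.mp hGF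
        refine mem_subdivideFaces.mpr (Or.inr ⟨G.erase (u + v), K.down_closed F' hF' _ hsub,
          fun h => hF'' ⟨hsub h.1, hsub h.2⟩, K.down_closed _ hst _ ?_, Finset.insert_erase hw⟩)
        exact Finset.insert_subset_insert _ (Finset.insert_subset_insert _ hsub)
      · have hsub : G ⊆ F' := (Finset.subset_insert_iff_of_notMem hw).mp hGF
        exact mem_subdivideFaces.mpr (Or.inl
          ⟨K.down_closed F' hF' G hsub, fun h => hF'' ⟨hsub h.1, hsub h.2⟩⟩)
  exists_basis := by
    intro F hF
    rcases mem_subdivideFaces.mp hF with ⟨hF', -⟩ | ⟨G, hG, hG', hst, rfl⟩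
    · exact K.exists_basis F hF'
    · obtain ⟨b, hb⟩ := K.exists_basis _ hst
      have hbu : u ∈ Set.range b := hb (by simp)
      have hbv : v ∈ Set.range b := hb (by simp)
      have hbG : (G : Set N) ⊆ Set.range b := fun y hy => hb (by simp [Finset.mem_coe.mp hy])
      by_cases hu : u ∈ G
      · rw [add_comm]
        exact exists_basis_insert_add b hne.symm hbv hbu (fun hv => hG' ⟨hu, hv⟩) hbG
      · exact exists_basis_insert_add b hne hbu hbv hu hbG
  realize_inj := by
    intro F hF G hG a a' ha ha' haF haG h
    obtain ⟨h1, ⟨F', hF', hF''⟩, hmin⟩ := exists_coarsen_face huv hF ha haF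
    obtain ⟨h1', ⟨G', hG', hG''⟩, hmin'⟩ := exists_coarsen_face huv hG ha' haG
    have heq : coarsen u v a = coarsen u v a' :=
      K.realize_inj F' hF' G' hG' _ _ h1 h1' hF'' hG'' (by simpa only [realize_coarsen] using h)
    have hu : u ≠ 0 := ne_zero_of_mem huv (by simp)
    have hv : v ≠ 0 := ne_zero_of_mem huv (by simp)
    -- the coefficient of `u + v` is the minimum of the coarsened coefficients of `u` and `v`
    have hcoef : ∀ a : N →₀ ℝ, min (a u) (a v) = 0 →
        min (coarsen u v a u) (coarsen u v a v) = a (u + v) := by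
      intro a ha
      have e1 : coarsen u v a u = a u + a (u + v) := by
        simp [coarsen_apply, hne.symm, hv]
      have e2 : coarsen u v a v = a v + a (u + v) := by
        simp [coarsen_apply, hne, hu]
      rw [e1, e2, min_add_add_right, ha, zero_add]
    have hw : a (u + v) = a' (u + v) := by
      rw [← hcoef a hmin, ← hcoef a' hmin', heq]
    ext y
    have := DFunLike.congr_fun heq y
    rw [coarsen_apply, coarsen_apply, hw] at this
    exact add_right_cancel this

theorem IsComplete.subdivide {K : SmoothComplex N} (hK : K.IsComplete) {u v : N} (hne : u ≠ v)
    (huv : {u, v} ∈ K.faces) : (K.subdivide hne huv).IsComplete := by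
  intro x
  obtain ⟨F, hF, hx⟩ := hK x
  by_cases hF' : u ∈ F ∧ v ∈ F
  swap
  · exact ⟨F, mem_subdivideFaces.mpr (Or.inl ⟨hF, hF'⟩), hx⟩
  obtain ⟨a, ha, haF, rfl⟩ := mem_coneOf.mp hx
  -- the smaller of the coefficients of `u` and `v` moves to `u + v`
  have key : ∀ u v : N, u ≠ v → u ∈ F → v ∈ F → a u ≤ a v →
      realize a ∈ coneOf ((insert (u + v) (F.erase u) : Finset N) : Set N) := by
    intro u v hne hu hv hle
    have e : realize a = realize (a.erase u - Finsupp.single v (a u)) + a u • toReal N (u + v) := by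
      conv_lhs => rw [← Finsupp.single_add_erase u a]
      simp only [map_add, map_sub, realize_single, smul_add]
      abel
    rw [e]
    refine add_mem (realize_mem_of_forall (fun y => ?_) fun y hy => toReal_mem_coneOf ?_)
      (PointedCone.smul_mem _ (ha u) (toReal_mem_coneOf (by simp)))
    · have := ha y
      simp only [Finsupp.coe_sub, Pi.sub_apply, Finsupp.erase_apply, Finsupp.single_apply]
      split_ifs with h1 h2 h3
      · exact absurd (h2.trans h1).symm hne
      · simp
      · subst h3
        linarith
      · simpa using this
    · rw [Finset.mem_coe, Finset.mem_insert, Finset.mem_erase]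
      refine Or.inr ⟨?_, ?_⟩
      · rintro rfl
        simp [hne] at hy
      · by_contra hyF
        have h0 : a y = 0 := by
          by_contra h
          exact hyF (haF y h)
        have hvy : v ≠ y := fun h => hyF (h ▸ hv)
        simp [Finsupp.erase_apply, h0, hvy] at hy
  have hst : insert u (insert v F) = F := by
    rw [Finset.insert_eq_of_mem hF'.2, Finset.insert_eq_of_mem hF'.1]
  have hface : ∀ y, y = u ∨ y = v → insert (u + v) (F.erase y) ∈ (K.subdivide hne huv).faces := by
    intro y hy
    refine mem_subdivideFaces.mpr (Or.inr ⟨F.erase y,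
      K.down_closed F hF _ (Finset.erase_subset _ _), ?_, K.down_closed F hF _ ?_, rfl⟩)
    · rintro ⟨h1, h2⟩
      rcases hy with rfl | rfl
      · simp at h1
      · simp at h2
    · rw [Finset.insert_subset_iff, Finset.insert_subset_iff]
      exact ⟨hF'.1, hF'.2, Finset.erase_subset _ _⟩
  rcases le_total (a u) (a v) with hle | hle
  · exact ⟨_, hface u (Or.inl rfl), key u v hne hF'.1 hF'.2 hle⟩
  · refine ⟨_, hface v (Or.inr rfl), ?_⟩
    rw [add_comm]
    exact key v u hne.symm hF'.2 hF'.1 hle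

theorem ConstantSign.subdivide {K : SmoothComplex N} {l : N →ₗ[ℤ] ℤ} (hK : K.ConstantSign l)
    {u v : N} (hne : u ≠ v) (huv : {u, v} ∈ K.faces) : (K.subdivide hne huv).ConstantSign l := by
  intro F hF
  rcases mem_subdivideFaces.mp hF with ⟨hF', -⟩ | ⟨G, hG, hG', hst, rfl⟩
  · exact hK F hF'
  · refine (hK _ hst).imp (fun h => ?_) fun h => ?_
    · intro y hy
      rcases Finset.mem_insert.mp hy with rfl | hy
      · rw [map_add]
        exact add_nonneg (h u (by simp)) (h v (by simp))
      · exact h y (by simp [hy])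
    · intro y hy
      rcases Finset.mem_insert.mp hy with rfl | hy
      · rw [map_add]
        exact add_nonpos (h u (by simp)) (h v (by simp))
      · exact h y (by simp [hy])

end Subdivision

/-! ### Subdivisions of constant signs -/

section Signs

variable [DecidableEq N]

/-- The edges on which `l` changes sign with total variation `M`. -/
def crossingEdges (K : SmoothComplex N) (l : N →ₗ[ℤ] ℤ) (M : ℤ) : Finset (N × N) :=
  (K.faces.biUnion id ×ˢ K.faces.biUnion id).filter fun p =>
    {p.1, p.2} ∈ K.faces ∧ 0 < l p.1 ∧ l p.2 < 0 ∧ l p.1 - l p.2 = M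

theorem mem_crossingEdges {K : SmoothComplex N} {l : N →ₗ[ℤ] ℤ} {M : ℤ} {y z : N} :
    (y, z) ∈ K.crossingEdges l M ↔
      {y, z} ∈ K.faces ∧ 0 < l y ∧ l z < 0 ∧ l y - l z = M := by
  simp only [crossingEdges, Finset.mem_filter, Finset.mem_product, Finset.mem_biUnion, id,
    and_iff_right_iff_imp]
  intro h
  exact ⟨⟨_, h.1, by simp⟩, ⟨_, h.1, by simp⟩⟩

/-- Subdividing an edge on which `l` changes sign with maximal variation creates only edges on
which `l` changes sign with smaller variation. -/
theorem crossing_subdivide {K : SmoothComplex N} {l : N →ₗ[ℤ] ℤ} {M : ℤ}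
    (hM : ∀ y z, {y, z} ∈ K.faces → 0 < l y → l z < 0 → l y - l z ≤ M) {u v : N} (hne : u ≠ v)
    (huv : {u, v} ∈ K.faces) (hu : 0 < l u) (hv : l v < 0) {y z : N}
    (hyz : {y, z} ∈ (K.subdivide hne huv).faces) (hy : 0 < l y) (hz : l z < 0) :
    ({y, z} ∈ K.faces ∧ (y, z) ≠ (u, v)) ∨ l y - l z < M := by
  rcases mem_subdivideFaces.mp hyz with ⟨h, h'⟩ | ⟨G, hG, hG', hst, hGF⟩
  · refine Or.inl ⟨h, fun h0 => h' ?_⟩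
    obtain ⟨rfl, rfl⟩ := Prod.mk.inj h0
    simp
  · right
    have hyG : y = u + v ∨ y ∈ G := by
      rw [← Finset.mem_insert, hGF]; simp
    have hzG : z = u + v ∨ z ∈ G := by
      rw [← Finset.mem_insert, hGF]; simp
    have hw : u + v = y ∨ u + v = z := by
      have : u + v ∈ ({y, z} : Finset N) := by rw [← hGF]; simp
      simpa using this
    have hyz : y ≠ z := by
      rintro rfl
      exact absurd hy hz.not_gt
    rcases hw with rfl | rfl
    · have hzG := hzG.resolve_left hyz.symm
      have h1 : {u, z} ∈ K.faces := K.down_closed _ hst _ (by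
        intro t ht
        rcases Finset.mem_insert.mp ht with rfl | ht
        · simp
        · rw [Finset.mem_singleton.mp ht]; simp [hzG])
      have h2 := hM u z h1 hu hz
      rw [map_add]
      linarith
    · have hyG := hyG.resolve_left hyz
      have h1 : {y, v} ∈ K.faces := K.down_closed _ hst _ (by
        intro t ht
        rcases Finset.mem_insert.mp ht with rfl | ht
        · simp [hyG]
        · rw [Finset.mem_singleton.mp ht]; simp)
      have h2 := hM y v h1 hy hv
      rw [map_add]
      linarith

theorem constantSign_of_forall_edge {K : SmoothComplex N} {l : N →ₗ[ℤ] ℤ}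
    (h : ∀ y z, {y, z} ∈ K.faces → 0 < l y → 0 ≤ l z) : K.ConstantSign l := by
  intro F hF
  by_contra! hcon
  obtain ⟨⟨z, hz, hz'⟩, y, hy, hy'⟩ := hcon
  refine absurd (h y z (K.down_closed F hF _ ?_) hy') hz'.not_ge
  rw [Finset.insert_subset_iff, Finset.singleton_subset_iff]
  exact ⟨hy, hz⟩

/-- The induction on the maximal variation `M` of `l` along an edge where `l` changes sign, and
on the number of edges where it is attained. -/
theorem exists_constantSign_of_bound (l : N →ₗ[ℤ] ℤ) (M : ℕ) : ∀ K : SmoothComplex N,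
    K.IsComplete → (∀ y z, {y, z} ∈ K.faces → 0 < l y → l z < 0 → l y - l z ≤ M) →
    ∃ K' : SmoothComplex N, K'.IsComplete ∧ K'.ConstantSign l ∧
      ∀ l', K.ConstantSign l' → K'.ConstantSign l' := by
  induction M with
  | zero =>
    intro K hK hM
    refine ⟨K, hK, constantSign_of_forall_edge fun y z hyz hy => ?_, fun _ h => h⟩
    by_contra! hz
    have := hM y z hyz hy hz
    push_cast at this
    linarith
  | succ M ihM =>
    intro K hK hM
    obtain ⟨n, hn⟩ : ∃ n, n = (K.crossingEdges l ((M + 1 : ℕ) : ℤ)).card := ⟨_, rfl⟩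
    induction n using Nat.strong_induction_on generalizing K with
    | _ n ihn =>
    rcases (K.crossingEdges l ((M + 1 : ℕ) : ℤ)).eq_empty_or_nonempty with hempty | ⟨⟨u, v⟩, huv⟩
    · refine ihM K hK fun y z hyz hy hz => ?_
      have h1 := hM y z hyz hy hz
      have h2 : l y - l z ≠ (M + 1 : ℕ) := fun h => by
        have : (y, z) ∈ K.crossingEdges l ((M + 1 : ℕ) : ℤ) :=
          mem_crossingEdges.mpr ⟨hyz, hy, hz, h⟩
        rw [hempty] at this
        simp at this
      push_cast at h1 h2
      omega
    · obtain ⟨hface, hu, hv, hval⟩ := mem_crossingEdges.mp huv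
      have hne : u ≠ v := by
        rintro rfl
        exact absurd hu hv.not_gt
      have hcross := @crossing_subdivide N _ _ K l _ hM u v hne hface hu hv
      have hlt : ((K.subdivide hne hface).crossingEdges l (M + 1 : ℕ)).card <
          (K.crossingEdges l ((M + 1 : ℕ) : ℤ)).card := by
        refine Finset.card_lt_card ((Finset.ssubset_iff_of_subset ?_).mpr ⟨(u, v), huv, ?_⟩)
        · rintro ⟨y, z⟩ hyz
          obtain ⟨h1, h2, h3, h4⟩ := mem_crossingEdges.mp hyz
          rcases hcross h1 h2 h3 with h | h
          · exact mem_crossingEdges.mpr ⟨h.1, h2, h3, h4⟩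
          · exact absurd h4 h.ne
        · intro h
          obtain ⟨h1, h2, h3, h4⟩ := mem_crossingEdges.mp h
          rcases hcross h1 h2 h3 with h | h
          · exact h.2 rfl
          · exact absurd h4 h.ne
      obtain ⟨K', h1, h2, h3⟩ := ihn _ (hn ▸ hlt) (K.subdivide hne hface)
        (hK.subdivide hne hface) (fun y z hyz hy hz => by
          rcases hcross hyz hy hz with h | h
          · exact hM y z h.1 hy hz
          · exact h.le) rfl
      exact ⟨K', h1, h2, fun l' hl' => h3 l' (hl'.subdivide hne hface)⟩

/-- A complete smooth complex can be subdivided so that a given functional has constant sign on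
each cone, without losing this property for other functionals. -/
theorem exists_constantSign (l : N →ₗ[ℤ] ℤ) (K : SmoothComplex N) (hK : K.IsComplete) :
    ∃ K' : SmoothComplex N, K'.IsComplete ∧ K'.ConstantSign l ∧
      ∀ l', K.ConstantSign l' → K'.ConstantSign l' := by
  let V := K.faces.biUnion id
  refine exists_constantSign_of_bound l (∑ y ∈ V, ∑ z ∈ V, (l y - l z).toNat) K hK
    fun y z hyz _ _ => ?_
  have hy : y ∈ V := Finset.mem_biUnion.mpr ⟨_, hyz, by simp⟩
  have hz : z ∈ V := Finset.mem_biUnion.mpr ⟨_, hyz, by simp⟩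
  have h1 : (l y - l z).toNat ≤ ∑ z ∈ V, (l y - l z).toNat :=
    Finset.single_le_sum (f := fun z => (l y - l z).toNat) (fun _ _ => Nat.zero_le _) hz
  have h2 : ∑ z ∈ V, (l y - l z).toNat ≤ ∑ y ∈ V, ∑ z ∈ V, (l y - l z).toNat :=
    Finset.single_le_sum (f := fun y => ∑ z ∈ V, (l y - l z).toNat) (fun _ _ => Nat.zero_le _) hy
  have h3 := Int.self_le_toNat (l y - l z)
  have h4 : (((l y - l z).toNat : ℕ) : ℤ) ≤ ((∑ y ∈ V, ∑ z ∈ V, (l y - l z).toNat : ℕ) : ℤ) := by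
    exact_mod_cast h1.trans h2
  exact h3.trans h4

end Signs

/-! ### The complex of coordinate orthants -/

section Orthants

variable {b : Module.Basis (Fin (Module.finrank ℤ N)) ℤ N}

theorem basis_ne_neg (i : Fin (Module.finrank ℤ N)) : b i ≠ -b i := by
  intro h
  have := congrArg (b.coord i) h
  simp at this

variable [DecidableEq N]

/-- The faces of the fan of coordinate orthants: sets of basis vectors and their opposites that
contain no opposite pair. -/
noncomputable def orthantFaces (b : Module.Basis (Fin (Module.finrank ℤ N)) ℤ N) :
    Finset (Finset N) :=
  (Finset.univ.image b ∪ Finset.univ.image fun i => -b i).powerset.filter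
    fun F => ∀ i, ¬(b i ∈ F ∧ -b i ∈ F)

theorem mem_orthantFaces {F : Finset N} : F ∈ orthantFaces b ↔
    (∀ y ∈ F, ∃ i, y = b i ∨ y = -b i) ∧ ∀ i, ¬(b i ∈ F ∧ -b i ∈ F) := by
  simp only [orthantFaces, Finset.mem_filter, Finset.mem_powerset, Finset.subset_iff,
    Finset.mem_union, Finset.mem_image, Finset.mem_univ, true_and]
  refine and_congr_left fun _ => forall₂_congr fun y _ => ?_
  rw [← exists_or]
  simp only [eq_comm]

/-- On the realization of the orthant complex, the `i`-th coordinate is the difference of the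
coefficients of `b i` and `-b i`, at most one of which is nonzero. -/
theorem realFunctional_coord {F : Finset N} (hF : F ∈ orthantFaces b) {a : N →₀ ℝ}
    (haF : ∀ y, a y ≠ 0 → y ∈ F) (i : Fin (Module.finrank ℤ N)) :
    realFunctional (b.coord i) (realize a) = a (b i) - a (-b i) := by
  rw [realFunctional_realize, Finsupp.sum_of_support_subset a
    (s := a.support ∪ {b i, -b i}) Finset.subset_union_left _ (by simp)]
  rw [← Finset.sum_subset (s₁ := {b i, -b i}) Finset.subset_union_right,
    Finset.sum_pair (basis_ne_neg i)]
  · simp [sub_eq_add_neg]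
  · intro y hy hy'
    have hya : a y ≠ 0 := 
      Finsupp.mem_support_iff.mp ((Finset.mem_union.mp hy).resolve_right hy')
    obtain ⟨j, hj⟩ := (mem_orthantFaces.mp hF).1 y (haF y hya)
    have hji : j ≠ i := by
      rintro rfl
      exact hy' (by simpa using hj)
    rcases hj with rfl | rfl <;> simp [hji]

/-- The complex of coordinate orthants with respect to a basis of `N`. -/
noncomputable def orthants (b : Module.Basis (Fin (Module.finrank ℤ N)) ℤ N) : SmoothComplex N where
  faces := orthantFaces b
  down_closed := by
    intro F hF G hG
    rw [mem_orthantFaces] at hF ⊢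
    exact ⟨fun y hy => hF.1 y (hG hy), fun i h => hF.2 i ⟨hG h.1, hG h.2⟩⟩
  exists_basis := by
    intro F hF
    rw [mem_orthantFaces] at hF
    refine ⟨b.unitsSMul fun i => if -b i ∈ F then -1 else 1, fun y hy => ?_⟩
    obtain ⟨i, rfl | rfl⟩ := hF.1 y hy
    · have : -b i ∉ F := fun h => hF.2 i ⟨hy, h⟩
      exact ⟨i, by simp [Module.Basis.unitsSMul_apply, this]⟩
    · exact ⟨i, by simp [Module.Basis.unitsSMul_apply, Finset.mem_coe.mp hy]⟩
  realize_inj := by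
    intro F hF G hG a a' ha ha' haF haG h
    have hcoord : ∀ i, a (b i) - a (-b i) = a' (b i) - a' (-b i) := fun i => by
      rw [← realFunctional_coord hF haF, ← realFunctional_coord hG haG, h]
    have hzero : ∀ {F : Finset N}, F ∈ orthantFaces b → ∀ {a : N →₀ ℝ}, (∀ y, a y ≠ 0 → y ∈ F) →
        ∀ i, a (b i) = 0 ∨ a (-b i) = 0 := by
      intro F hF a haF i
      by_contra! hcon
      exact (mem_orthantFaces.mp hF).2 i ⟨haF _ hcon.1, haF _ hcon.2⟩
    have hboth : ∀ i, a (b i) = a' (b i) ∧ a (-b i) = a' (-b i) := by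
      intro i
      have h1 := hcoord i
      have := ha (b i)
      have := ha (-b i)
      have := ha' (b i)
      have := ha' (-b i)
      rcases hzero hF haF i with h | h <;> rcases hzero hG haG i with h' | h' <;>
        constructor <;> linarith
    ext y
    by_cases hy : y ∈ F ∪ G
    · obtain ⟨i, rfl | rfl⟩ : ∃ i, y = b i ∨ y = -b i := by
        rcases Finset.mem_union.mp hy with hy | hy
        · exact (mem_orthantFaces.mp hF).1 y hy
        · exact (mem_orthantFaces.mp hG).1 y hy
      · exact (hboth i).1
      · exact (hboth i).2
    · rw [Finset.mem_union, not_or] at hy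
      have h1 : a y = 0 := by
        by_contra h
        exact hy.1 (haF y h)
      have h2 : a' y = 0 := by
        by_contra h
        exact hy.2 (haG y h)
      rw [h1, h2]

theorem isComplete_orthants (b : Module.Basis (Fin (Module.finrank ℤ N)) ℤ N) :
    (orthants b).IsComplete := by
  intro x
  let B := Algebra.TensorProduct.basis ℝ b
  let e : Fin (Module.finrank ℤ N) → N := fun i => if 0 ≤ B.repr x i then b i else -b i
  have hcoord : ∀ i j, b.coord i (e j) =
      if j = i then (if 0 ≤ B.repr x i then 1 else -1) else 0 := by
    intro i j
    by_cases hij : j = i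
    · subst hij
      by_cases h : 0 ≤ B.repr x j <;> simp [e, h]
    · by_cases h : 0 ≤ B.repr x j <;> simp [e, h, hij]
  refine ⟨Finset.univ.image e, mem_orthantFaces.mpr ⟨?_, ?_⟩, ?_⟩
  · intro y hy
    obtain ⟨i, -, rfl⟩ := Finset.mem_image.mp hy
    refine ⟨i, ?_⟩
    by_cases h : 0 ≤ B.repr x i <;> simp [e, h]
  · rintro i ⟨h1, h2⟩
    obtain ⟨j, -, hj⟩ := Finset.mem_image.mp h1
    obtain ⟨k, -, hk⟩ := Finset.mem_image.mp h2
    have hj' := hcoord i j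
    have hk' := hcoord i k
    rw [hj] at hj'
    rw [hk] at hk'
    by_cases h : 0 ≤ B.repr x i <;> simp [h] at hj' hk' <;> grind
  · rw [← B.sum_repr x]
    refine sum_mem fun i _ => ?_
    have h1 : B.repr x i • B i = |B.repr x i| • toReal N (e i) := by
      have hBi : B i = toReal N (b i) := Algebra.TensorProduct.basis_apply b i
      rw [hBi]
      by_cases h : 0 ≤ B.repr x i
      · simp [e, h, abs_of_nonneg h]
      · simp [e, h, abs_of_neg (not_le.mp h)]
    rw [h1]
    exact PointedCone.smul_mem _ (abs_nonneg _) (toReal_mem_coneOf (by simp))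

theorem exists_isComplete_constantSign [Module.Free ℤ N] [Module.Finite ℤ N]
    (L : Finset (N →ₗ[ℤ] ℤ)) :
    ∃ K : SmoothComplex N, K.IsComplete ∧ ∀ l ∈ L, K.ConstantSign l := by
  classical
  induction L using Finset.induction_on with
  | empty => exact ⟨_, isComplete_orthants (Module.finBasis ℤ N), by simp⟩
  | insert l L _ ih =>
    obtain ⟨K, hK, hL⟩ := ih
    obtain ⟨K', h1, h2, h3⟩ := exists_constantSign l K hK
    refine ⟨K', h1, fun l' hl' => ?_⟩
    rcases Finset.mem_insert.mp hl' with rfl | hl'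
    · exact h2
    · exact h3 l' (hL l' hl')

end Orthants

end SmoothComplex

/-! ### The fan supported on the cone of a saturated semigroup -/

section Support

variable {N : Type u} [AddCommGroup N]

theorem SmoothComplex.constantSigns {K : SmoothComplex N} {L : Finset (N →ₗ[ℤ] ℤ)}
    (h : ∀ l ∈ L, K.ConstantSign l) {F : Finset N} (hF : F ∈ K.faces) :
    ConstantSigns (L : Set (N →ₗ[ℤ] ℤ)) (F : Set N) :=
  fun l hl => h l hl F hF

theorem IsSaturated.mem_of_nsmul_mem {S : AddSubmonoid N} (hS : IsSaturated S) {n : ℕ}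
    (hn : 0 < n) {y : N} (hy : n • y ∈ S) : y ∈ S := by
  rw [← hS]
  have h1 : toReal N (n • y) ∈ coneOf (S : Set N) := toReal_mem_coneOf hy
  have hn' : (n : ℝ) ≠ 0 := by exact_mod_cast hn.ne'
  have h2 : toReal N y = (n : ℝ)⁻¹ • toReal N (n • y) := by
    rw [map_nsmul, ← Nat.cast_smul_eq_nsmul ℝ, smul_smul, inv_mul_cancel₀ hn', one_smul]
  change toReal N y ∈ coneOf (S : Set N)
  rw [h2]
  exact PointedCone.smul_mem _ (by positivity) h1

/-- If the facet functionals of the cones on independent generators of `S` have constant signs on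
a complete complex, then its cones on vectors of `S` cover the cone of `S`. -/
theorem support_toFan_restrict {S : AddSubmonoid N} (hS : IsSaturated S) {g : Finset N}
    (hg : AddSubmonoid.closure (g : Set N) = S) {D : ℕ} (hD : 0 < D) {L : Finset (N →ₗ[ℤ] ℤ)}
    (hL : Facets (fun j : g => (j : N)) D L) {K : SmoothComplex N} (hK : K.IsComplete)
    (hKL : ∀ l ∈ L, K.ConstantSign l) :
    (K.restrict (S : Set N)).toFan.support = (coneOf (S : Set N) : Set (RealSpan N)) := by
  apply Set.Subset.antisymm
  · refine Set.iUnion₂_subset ?_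
    rintro _ ⟨F, hF, rfl⟩
    exact coneOf_le_iff.mpr fun y hy =>
      toReal_mem_coneOf ((SmoothComplex.mem_faces_restrict.mp hF).2 hy)
  · intro x hx
    have hx' : x ∈ coneOf (Set.range fun j : g => (j : N)) := by
      refine coneOf_le_iff.mpr (fun y hy => ?_) hx
      rw [← hg] at hy
      simpa using toReal_mem_coneOf_closure hy
    obtain ⟨k, hk, hli, hkx⟩ := exists_linearIndepOn_of_mem_coneOf _ hx'
    obtain ⟨L', hL', hpos, hcut⟩ := hL _ hli
    obtain ⟨F, hF, hxF⟩ := hK x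
    obtain ⟨a, ha, haF, hax⟩ := mem_coneOf.mp hxF
    have hsub : a.support ⊆ F := fun y hy => haF y (Finsupp.mem_support_iff.mp hy)
    have hface : a.support ∈ K.faces := K.down_closed F hF _ hsub
    have haS : ∀ y, a y ≠ 0 → y ∈ S := by
      intro y hy
      obtain ⟨c, -, hc⟩ := hcut y fun l hl => by
        refine (SmoothComplex.constantSigns hKL hface).nonneg_of_sum (hL' hl)
          (e := fun z : a.support => (z : N)) (w := fun z => a z) (fun z => ha z)
          (fun z _ => z.2) ?_ (i := ⟨y, Finsupp.mem_support_iff.mpr hy⟩) hy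
        have h1 : ∑ z : a.support, a z * (l z : ℝ) = realFunctional l x := by
          rw [← hax, realFunctional_realize, Finsupp.sum]
          exact Finset.sum_coe_sort a.support fun z => a z * (l z : ℝ)
        rw [h1, ← hkx, map_sum]
        refine Finset.sum_nonneg fun j _ => ?_
        rw [map_smul, realFunctional_toReal]
        by_cases hj : k j = 0
        · simp [hj]
        · exact mul_nonneg (hk j) (by exact_mod_cast hpos l hl j hj)
      refine hS.mem_of_nsmul_mem hD ?_
      rw [← hc]
      refine sum_mem fun j _ => nsmul_mem ?_ _
      rw [← hg]
      exact AddSubmonoid.subset_closure j.2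
    refine Set.mem_biUnion (SmoothComplex.mem_cones_toFan.mpr
      ⟨a.support, SmoothComplex.mem_faces_restrict.mpr ⟨hface, fun y hy => haS y ?_⟩, rfl⟩) ?_
    · exact Finsupp.mem_support_iff.mp hy
    · exact mem_coneOf.mpr ⟨a, ha, fun y hy => Finsupp.mem_support_iff.mpr hy, hax⟩

end Support

/-! ### Operations on ideal sheaves over an affine open -/

section IdealSheaves

variable {X : Scheme.{v}}

theorem ideal_prod {κ : Type*} (s : Finset κ) (I : κ → X.IdealSheafData) (U : X.affineOpens) :
    (∏ i ∈ s, I i).ideal U = ∏ i ∈ s, (I i).ideal U := by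
  classical
  induction s using Finset.induction_on with
  | empty => simp [Ideal.one_eq_top]
  | insert i s hi ih =>
    rw [Finset.prod_insert hi, Finset.prod_insert hi, Scheme.IdealSheafData.ideal_mul,
      Pi.mul_apply, ih]

theorem ideal_sheafIntegralClosure (I : X.IdealSheafData) (U : X.affineOpens) :
    (sheafIntegralClosure I).ideal U = integralClosure (I.ideal U) := rfl

end IdealSheaves

end GradedIdeals

open GradedIdeals in
theorem proposition4p5 {N : Type u} [AddCommGroup N] [Module.Free ℤ N] [Module.Finite ℤ N]
    (S : AddSubmonoid N) (hS : S.FG) (hsat : IsSaturated S)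
    (X : Scheme.{v}) [IsNoetherian X]
    (a : GradedSystem S X) (ha : a.FinitelyGenerated) :
    ∃ D : Fan N, D.IsSmooth ∧
      D.support = (coneOf (S : Set N) : Set (RealSpan N)) ∧
      ∀ D' : Fan N, D'.IsSmooth → D'.Refines D →
        ∃ d : ℕ, 0 < d ∧
          ∀ σ ∈ D'.cones, ∀ (s : ℕ) (e : Fin s → S), AreGenerators σ (fun i => (e i : N)) →
            ∀ p : Fin s → ℕ,
              sheafIntegralClosure (a.ideal (d • ∑ i, p i • e i)) =
                sheafIntegralClosure (∏ i, a.ideal (d • e i) ^ p i) := by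
  classical
  choose U hxU hU using ha
  obtain ⟨t, ht⟩ := isCompact_univ.elim_finite_subcover (fun x => ((U x).1 : Set X))
    (fun x => (U x).1.isOpen) fun x _ => Set.mem_iUnion.mpr ⟨x, hxU x⟩
  have hcover : ⨆ x : t, (U x).1 = ⊤ := by
    rw [eq_top_iff]
    intro x hx
    obtain ⟨i, hi, hxi⟩ := Set.mem_iUnion₂.mp (ht hx)
    exact TopologicalSpace.Opens.mem_iSup.mpr ⟨⟨i, hi⟩, hxi⟩
  choose ι hι m y hy hgen using fun x => a.exists_generators (U x) (hU x)
  choose D L hD hL using fun x => exists_facets fun j => (m x j : N)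
  obtain ⟨g, hg⟩ := hS
  obtain ⟨D₀, L₀, hD₀, hL₀⟩ := exists_facets fun j : g => (j : N)
  obtain ⟨K, hK, hKL⟩ := SmoothComplex.exists_isComplete_constantSign (L₀ ∪ t.biUnion L)
  refine ⟨(K.restrict (S : Set N)).toFan, SmoothComplex.isSmooth_toFan _,
    support_toFan_restrict hsat hg hD₀ hL₀ hK fun l hl => hKL l (Finset.mem_union_left _ hl),
    fun D' _ hD' => ⟨∏ x ∈ t, D x, Finset.prod_pos fun x _ => hD x, ?_⟩⟩
  intro σ hσ s e he p
  obtain ⟨_, ⟨F, hF, rfl⟩, hσF⟩ := hD'.2 σ hσ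
  have hsigns := (SmoothComplex.constantSigns hKL
    (SmoothComplex.mem_faces_restrict.mp hF).1).latticePoints
  have heF : ∀ i, (e i : N) ∈ {y | toReal N y ∈ coneOf (F : Set N)} := by
    intro i
    have h : (e i : N) ∈ latticePoints σ := by
      rw [← he.2]
      exact AddSubmonoid.subset_closure ⟨i, rfl⟩
    exact hσF h
  refine Scheme.IdealSheafData.ext_of_iSup_eq_top (fun x : t => U x) hcover fun x => ?_
  rw [ideal_sheafIntegralClosure, ideal_sheafIntegralClosure, ideal_prod]
  exact integralClosure_eq_prod (𝔞 := fun n => (a.ideal n).ideal (U x))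
    (by rw [a.ideal_zero]; rfl) (fun n n' => a.mul_le n n' (U x)) (hy x) (hgen x)
    (Finset.prod_pos fun x _ => hD x)
    ((hL x).mono (Finset.dvd_prod_of_mem D x.2)
      ((Finset.subset_biUnion_of_mem L x.2).trans Finset.subset_union_right))
    hsigns heF p
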